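/- Let $(G,\Omega)$ be an oligomorphic permutation group, i.e. $G$ acts faithfully on the set $\Omega$ with finitely many orbits on $\Omega^n$ for every $n\ge 0$. For a finite $A\subseteq\Omega$ let $G(A)$ and $G[A]$ be the pointwise and the setwise stabilizer of $A$ in $G$. Call a set with an action of $G$ *smooth* here if it has finitely many $G$-orbits and the stabilizer of each of its points is of the form $G(A)$ with $A\subseteq\Omega$ finite; maps of such sets are $G$-equivariant maps, and such a set is transitive if it consists of exactly one orbit. Let $\Theta(G,\Omega)$ be the commutative ring generated by symbols $[f]$, one for each map $f\colon Y\to X$ of smooth sets with $X$ transitive, subject to the relations: (a) $[f]=1$ if $f$ is an isomorphism; (b) $[f]=[f|_{Y_1}]+[f|_{Y_2}]$ if $Y=Y_1\sqcup Y_2$ as $G$-sets; (c) $[f\circ g]=[f]\,[g]$ for maps $g\colon Z\to Y$ and $f\colon Y\to X$ of transitive smooth sets; (d) $[f]=[f']$ if $f'\colon Y\times_X X'\to X'$ is the base change of $f\colon Y\to X$ along a map $X'\to X$ of transitive smooth sets. Let $\Theta^*(G,\Omega)$ be the localization of $\Theta(G,\Omega)$ at the multiplicative set generated by the classes $[f]$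 of all maps $f\colon Y\to X$ with both $Y$ and $X$ transitive. Let $\Theta_{\le 1}(G,\Omega)$ be the additive subgroup of $\Theta(G,\Omega)$ generated by the classes of the maps $Y\to X$, where $Y$ is a $G$-orbit on $\Omega^{\ell+1}$ for some $\ell\ge 0$, $X$ is its image in $\Omega^{\ell}$ under the projection onto the first $\ell$ coordinates, and the map is this projection. Call $(G,\Omega)$ *odd* if for all maps $Y\to X$ and $Z\to X$ of transitive smooth sets the number of $G$-orbits on $Y\times_X Z$ is odd. Let $m$ be an odd positive integer such that - $\mathrm{GEN}(m)$: $\Theta_{\le 1}(G,\Omega)[1/m]$ is a finitely generated $\mathbf Z[1/m]$-module; - $\mathrm{IND}(m)$: for every finite $A\subseteq\Omega$, the index $[G[A]:G(A)]$ divides a power of $m$. Then there is a ring isomorphism $\Theta^*(G,\Omega)[1/m]\cong\mathbf Z[1/m]$ if $(G,\Omega)$ is odd, and $\Theta^*(G,\Omega)[1/m]=0$ otherwise. -/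

import Mathlib

open scoped Pointwise

universe u

namespace Oligo

section Groups

variable (G : Type u) [Group G] (Ω : Type u) [MulAction G Ω]

/-- The action of `G` on `Ω` is oligomorphic: `G` has finitely many orbits on `Ω ^ n` for
every `n`. -/
def IsOligomorphic : Prop :=
  ∀ n : ℕ, Finite (MulAction.orbitRel.Quotient G (Fin n → Ω))

/-- The condition `IND(m)`: for every finite `A ⊆ Ω` the index of the pointwise stabilizer `G(A)`
in the setwise stabilizer `G[A]` divides a power of `m`. -/
def IND (m : ℕ) : Prop :=
  ∀ A : Finset Ω, ∃ k : ℕ,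
    (fixingSubgroup G (A : Set Ω)).relIndex (MulAction.stabilizer G (A : Set Ω)) ∣ m ^ k

/-- The stabilizer class `ℰ(Ω)`: the pointwise stabilizers `G(A)` of the finite sets `A ⊆ Ω`.
These subgroups are open by the definition of the topology of `G`. -/
def stabClass : Set (Subgroup G) :=
  {U | ∃ A : Finset Ω, U = fixingSubgroup G (A : Set Ω)}

end Groups

section Smooth

variable {G : Type u} [Group G]

/-- An `ℰ`-smooth `G`-set: a set with an action of `G` that has finitely many orbits and all of
whose point stabilizers belong to `ℰ`. Every such set is isomorphic to a finite disjoint union of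
coset spaces of `G`, so the universe of `G` contains all of them up to isomorphism. -/
structure SmoothSet (E : Set (Subgroup G)) where
  carrier : Type u
  [act : MulAction G carrier]
  finitary : Finite (MulAction.orbitRel.Quotient G carrier)
  smooth : ∀ x : carrier, MulAction.stabilizer G x ∈ E

attribute [instance] SmoothSet.act

instance (E : Set (Subgroup G)) : CoeSort (SmoothSet E) (Type u) := ⟨SmoothSet.carrier⟩

/-- A `G`-set is transitive if it consists of exactly one orbit (so it is not empty). -/
def SmoothSet.IsTransitive {E : Set (Subgroup G)} (X : SmoothSet E) : Prop :=
  Nonempty X ∧ MulAction.IsPretransitive G X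

/-- The symbols `[f]`: maps `f : Y → X` of `ℰ`-smooth `G`-sets with `X` transitive. -/
structure Symb (E : Set (Subgroup G)) where
  Y : SmoothSet E
  X : SmoothSet E
  map : Y →[G] X
  trans : X.IsTransitive

/-- The relations (a)-(d) of a measure, as elements of the polynomial ring in the symbols. -/
inductive Rel (E : Set (Subgroup G)) : MvPolynomial (Symb E) ℤ → Prop
  /-- (a) an isomorphism has class `1` -/
  | iso (f : Symb E) (hf : Function.Bijective f.map) :
      Rel E (MvPolynomial.X f - 1)
  /-- (b) if `Y` is the disjoint union of `Y₁` and `Y₂` (by way of `i₁` and `i₂`), then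
  `[f] = [f|Y₁] + [f|Y₂]` -/
  | add {Y Y₁ Y₂ X : SmoothSet E} (hX : X.IsTransitive) (f : Y →[G] X)
      (i₁ : Y₁ →[G] Y) (i₂ : Y₂ →[G] Y) (hi : Function.Bijective (Sum.elim i₁ i₂)) :
      Rel E (MvPolynomial.X ⟨Y, X, f, hX⟩ -
        (MvPolynomial.X ⟨Y₁, X, f.comp i₁, hX⟩ + MvPolynomial.X ⟨Y₂, X, f.comp i₂, hX⟩))
  /-- (c) `[f ∘ g] = [f] [g]` for maps of transitive sets -/
  | comp {Z Y X : SmoothSet E} (_hZ : Z.IsTransitive) (hY : Y.IsTransitive) (hX : X.IsTransitive)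
      (g : Z →[G] Y) (f : Y →[G] X) :
      Rel E (MvPolynomial.X ⟨Z, X, f.comp g, hX⟩ -
        MvPolynomial.X ⟨Y, X, f, hX⟩ * MvPolynomial.X ⟨Z, Y, g, hY⟩)
  /-- (d) `[f] = [f']` if `f' : Y' → X'` is the base change of `f : Y → X` along `g : X' → X`:
  the square with sides `f'`, `g`, `h`, `f` commutes and identifies `Y'` with `Y ×_X X'` -/
  | baseChange {Y X Y' X' : SmoothSet E} (hX : X.IsTransitive) (hX' : X'.IsTransitive)
      (f : Y →[G] X) (g : X' →[G] X) (f' : Y' →[G] X') (h : Y' →[G] Y)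
      (comm : ∀ y', f (h y') = g (f' y'))
      (cart : ∀ (y : Y) (x' : X'), f y = g x' → ∃! y' : Y', h y' = y ∧ f' y' = x') :
      Rel E (MvPolynomial.X ⟨Y, X, f, hX⟩ - MvPolynomial.X ⟨Y', X', f', hX'⟩)

/-- The ring `Θ(G, ℰ)` carrying the universal measure. -/
abbrev Theta (E : Set (Subgroup G)) : Type (u + 1) :=
  MvPolynomial (Symb E) ℤ ⧸ Ideal.span {p | Rel E p}

/-- The class `[f]` in `Θ(G, ℰ)`. -/
noncomputable def cls {E : Set (Subgroup G)} (f : Symb E) : Theta E :=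
  Ideal.Quotient.mk _ (MvPolynomial.X f)

/-- The multiplicative set generated by the classes of maps between transitive sets. -/
noncomputable def regularMonoid (E : Set (Subgroup G)) : Submonoid (Theta E) :=
  Submonoid.closure {t | ∃ f : Symb E, f.Y.IsTransitive ∧ t = cls f}

/-- The ring `Θ^*(G, ℰ)` carrying the universal regular measure. -/
abbrev ThetaStar (E : Set (Subgroup G)) : Type (u + 1) :=
  Localization (regularMonoid E)

/-- The fiber product `Y ×_X Z`, as a `G`-stable subset of `Y × Z`. -/
def fiberProduct {Y Z X : Type u} [MulAction G Y] [MulAction G Z] [MulAction G X]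
    (f : Y →[G] X) (g : Z →[G] X) : SubMulAction G (Y × Z) where
  carrier := {p | f p.1 = g p.2}
  smul_mem' := by
    intro c p hp
    simp only [Set.mem_ofPred_eq, Prod.smul_fst, Prod.smul_snd, map_smul] at hp ⊢
    rw [hp]

end Smooth

section Odd

variable (G : Type u) [Group G] (Ω : Type u) [MulAction G Ω]

/-- `(G, Ω)` is odd: for all maps `Y → X` and `Z → X` of transitive `ℰ(Ω)`-smooth `G`-sets, the
number of `G`-orbits on `Y ×_X Z` is odd. -/
def IsOdd : Prop :=
  ∀ (Y Z X : SmoothSet (stabClass G Ω)), Y.IsTransitive → Z.IsTransitive → X.IsTransitive →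
    ∀ (f : Y →[G] X) (g : Z →[G] X),
      Odd (Nat.card (MulAction.orbitRel.Quotient G (fiberProduct f g)))

end Odd

section Basic

variable {G : Type u} [Group G] {Ω : Type u} [MulAction G Ω]

theorem stabilizer_mem_stabClass {n : ℕ} (x : Fin n → Ω) :
    MulAction.stabilizer G x ∈ stabClass G Ω := by
  classical
  refine ⟨Finset.univ.image x, ?_⟩
  ext g
  simp [MulAction.mem_stabilizer_iff, mem_fixingSubgroup_iff, funext_iff]

variable (G) in
/-- The `G`-orbit of a point of `Ω ^ n`, as an `ℰ(Ω)`-smooth `G`-set. -/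
def orbitSet {n : ℕ} (x : Fin n → Ω) : SmoothSet (stabClass G Ω) where
  carrier := MulAction.orbit G x
  finitary := by
    have : Subsingleton (MulAction.orbitRel.Quotient G (MulAction.orbit G x)) :=
      (MulAction.pretransitive_iff_subsingleton_quotient G _).1 inferInstance
    infer_instance
  smooth := by
    intro y
    have h : MulAction.stabilizer G y = MulAction.stabilizer G (y : Fin n → Ω) := by
      ext g
      simp [MulAction.mem_stabilizer_iff, Subtype.ext_iff]
    rw [h]
    exact stabilizer_mem_stabClass _

theorem orbitSet_isTransitive {n : ℕ} (x : Fin n → Ω) : (orbitSet G x).IsTransitive :=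
  ⟨⟨⟨x, MulAction.mem_orbit_self x⟩⟩,
    inferInstanceAs (MulAction.IsPretransitive G (MulAction.orbit G x))⟩

variable (G) in
/-- The basic map given by the `G`-orbit of `x : Ω ^ (l + 1)`: the projection onto the first `l`
coordinates, from this orbit to its image, an orbit on `Ω ^ l`. -/
def basicMap {l : ℕ} (x : Fin (l + 1) → Ω) : Symb (stabClass G Ω) where
  Y := orbitSet G x
  X := orbitSet G (fun i : Fin l => x i.castSucc)
  map :=
    { toFun := fun y => ⟨fun i : Fin l => y.1 i.castSucc, by
        obtain ⟨_, g, rfl⟩ := y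
        exact ⟨g, rfl⟩⟩
      map_smul' := fun _ _ => rfl }
  trans := orbitSet_isTransitive _

end Basic

section Gen

variable (G : Type u) [Group G] (Ω : Type u) [MulAction G Ω]

/-- `Θ_{≤ 1}(G, Ω)`: the additive subgroup of `Θ(G, Ω)` generated by the basic classes. -/
noncomputable def thetaLeOne : Submodule ℤ (Theta (stabClass G Ω)) :=
  Submodule.span ℤ {t | ∃ (l : ℕ) (x : Fin (l + 1) → Ω), t = cls (basicMap G x)}

/-- The condition `GEN(m)`: `Θ_{≤ 1}(G, Ω)[1/m]` is a finitely generated `ℤ[1/m]`-module. -/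
def GEN (m : ℕ) : Prop :=
  Module.Finite (Localization.Away (m : ℤ))
    (LocalizedModule (Submonoid.powers (m : ℤ)) (thetaLeOne G Ω))

end Gen

end Oligo

/-! Let p be a prime not dividing m. By `IND(m)`, no element of G rotates a nonconstant cyclic
p-tuple of points of a smooth set by a nonzero amount (`rotFree_stabClass`). So the nonconstant
p-tuples in the fibres of f : Y → X are the disjoint union of the p rotations of a G-stable
transversal T, and the p-fold fibre power of Y over X gives [f]^p = [f] + p[T → X] (`cl_pow_eq`).
This has two consequences.

First, Θ has no p-torsion. The substitution [f] ↦ [f]^p - p[T → X] defines a Frobenius lift φ on the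
polynomial ring in the symbols, and φ induces the identity on Θ. Each of the relations (a)-(d) has a
counterpart for transversals, so the relation ideal is stable under δ(x) = (φ(x) - x^p)/p
(`exists_frobLift_rel`). If px lies in the ideal, then so do δ(px) = φ(x) - p^(p-1) x^p, φ(x) and x
(`mem_of_prime_mul_mem`).

Second, for a basic class b the map T → X factors through Y and T → Y adjoins p - 1 points, so b^p =
b + pbc with c in the (p-1)-st power of Θ_{≤1} (`basicClasses_pow_eq`). The basic classes generate Θ
as a ring, and the class of a map of transitive sets is a product of them.

Let B = ℤ[1/m] and suppose R = Θ^*[1/m] is nonzero. In R the basic classes are units, so x^(p-1) = 1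
+ pc with c in M^(p-1), where M is the B-module spanned by 1 and the basic classes; it is finitely
generated by `GEN(m)`. As m is odd, p = 2 is allowed: M = B + 2M, and by Nakayama M has rank one.
The congruences at all p then force every basic class to be a unit of B
(`exists_isUnit_algebraMap_eq`), so R = B.

Since ℤ[1/m] reduces to 𝔽₂, R is nonzero exactly when Θ has a homomorphism to 𝔽₂ with value 1 on all
maps of transitive sets. It must send [f : Y → X] to the parity of the number of orbits of Y, and
compatibility with base change is oddness (`isOdd_iff_exists_hom`). -/

namespace Oligo

/-! ### Calculus of classes in Θ -/

section Classes

variable {G : Type u} [Group G] {E : Set (Subgroup G)}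

/-- The ideal of relations. -/
noncomputable abbrev relIdeal (E : Set (Subgroup G)) : Ideal (MvPolynomial (Symb E) ℤ) :=
  Ideal.span {p | Rel E p}

theorem mk_eq_mk_of_rel {a b : MvPolynomial (Symb E) ℤ} (h : Rel E (a - b)) :
    Ideal.Quotient.mk (relIdeal E) a = Ideal.Quotient.mk (relIdeal E) b :=
  Ideal.Quotient.eq.2 (Ideal.subset_span h)

/-- The class in `Θ(G, ℰ)` of a map `f : Y → X` with `X` transitive. -/
noncomputable def cl {Y X : SmoothSet E} (f : Y →[G] X) (hX : X.IsTransitive) : Theta E :=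
  cls ⟨Y, X, f, hX⟩

theorem cl_of_bijective {Y X : SmoothSet E} (f : Y →[G] X) (hX : X.IsTransitive)
    (hf : Function.Bijective f) : cl f hX = 1 :=
  mk_eq_mk_of_rel (Rel.iso ⟨Y, X, f, hX⟩ hf)

theorem cl_add {Y Y₁ Y₂ X : SmoothSet E} (hX : X.IsTransitive) (f : Y →[G] X)
    (i₁ : Y₁ →[G] Y) (i₂ : Y₂ →[G] Y) (hi : Function.Bijective (Sum.elim i₁ i₂)) :
    cl f hX = cl (f.comp i₁) hX + cl (f.comp i₂) hX :=
  (mk_eq_mk_of_rel (Rel.add hX f i₁ i₂ hi)).trans (map_add _ _ _)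

theorem cl_comp_of_isTransitive {Z Y X : SmoothSet E} (hZ : Z.IsTransitive) (hY : Y.IsTransitive)
    (hX : X.IsTransitive) (g : Z →[G] Y) (f : Y →[G] X) :
    cl (f.comp g) hX = cl f hX * cl g hY :=
  (mk_eq_mk_of_rel (Rel.comp hZ hY hX g f)).trans (map_mul _ _ _)

theorem cl_baseChange {Y X Y' X' : SmoothSet E} (hX : X.IsTransitive) (hX' : X'.IsTransitive)
    (f : Y →[G] X) (g : X' →[G] X) (f' : Y' →[G] X') (h : Y' →[G] Y)
    (comm : ∀ y', f (h y') = g (f' y'))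
    (cart : ∀ (y : Y) (x' : X'), f y = g x' → ∃! y' : Y', h y' = y ∧ f' y' = x') :
    cl f hX = cl f' hX' :=
  mk_eq_mk_of_rel (Rel.baseChange hX hX' f g f' h comm cart)

theorem orbits_map_injective {P Y : Type*} [MulAction G P] [MulAction G Y] (i : P →[G] Y)
    (hi : Function.Injective i) : Function.Injective
      (Quotient.map' i (by
        rintro a b ⟨g, rfl⟩
        exact ⟨g, (map_smul i g b).symm⟩) :
        MulAction.orbitRel.Quotient G P → MulAction.orbitRel.Quotient G Y) := by
  rintro ⟨a⟩ ⟨b⟩ h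
  obtain ⟨g, hg⟩ := Quotient.exact h
  refine Quotient.sound ⟨g, hi ?_⟩
  simpa using hg

theorem stabilizer_eq_of_injective {P Y : Type*} [MulAction G P] [MulAction G Y] (i : P →[G] Y)
    (hi : Function.Injective i) (x : P) :
    MulAction.stabilizer G x = MulAction.stabilizer G (i x) := by
  ext g
  simp only [MulAction.mem_stabilizer_iff, ← map_smul, hi.eq_iff]

/-- A `G`-set that embeds into a smooth set is smooth. -/
def SmoothSet.ofInjective {P : Type u} [MulAction G P] (Y : SmoothSet E) (i : P →[G] Y)
    (hi : Function.Injective i) : SmoothSet E where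
  carrier := P
  finitary := by
    have := Y.finitary
    exact Finite.of_injective _ (orbits_map_injective i hi)
  smooth x := by
    rw [stabilizer_eq_of_injective i hi]
    exact Y.smooth _

/-- A `G`-stable subset of a smooth set. -/
def SmoothSet.sub (Y : SmoothSet E) (S : SubMulAction G Y) : SmoothSet E :=
  Y.ofInjective S.subtype Subtype.val_injective

/-- The inclusion of a `G`-stable subset. -/
def SmoothSet.incl (Y : SmoothSet E) (S : SubMulAction G Y) : Y.sub S →[G] Y := S.subtype

@[simp] theorem SmoothSet.incl_apply (Y : SmoothSet E) (S : SubMulAction G Y) (s : S) :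
    Y.incl S s = (s : Y) := rfl

/-- The empty set is the disjoint union of two copies of itself, so relation (b) reads [f] = [f] +
[f]. -/
theorem cl_of_isEmpty {Y X : SmoothSet E} (f : Y →[G] X) (hX : X.IsTransitive) (hY : IsEmpty Y) :
    cl f hX = 0 := by
  have h := cl_add hX f (MulActionHom.id G) (MulActionHom.id G)
    ⟨fun a => hY.elim (Sum.elim id id a), fun a => hY.elim a⟩
  have e : f.comp (MulActionHom.id G) = f := by ext; rfl
  rw [e] at h
  exact left_eq_add.1 h

/-- Relation (c) is not available when Y is not transitive; relation (b) with an empty second part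
takes its place. -/
theorem cl_comp_bijective {Y Y' X : SmoothSet E} (f : Y →[G] X) (hX : X.IsTransitive)
    (i : Y' →[G] Y) (hi : Function.Bijective i) : cl (f.comp i) hX = cl f hX := by
  let S : SubMulAction G Y := ⊥
  have hS : IsEmpty (Y.sub S) := ⟨fun a => a.2⟩
  have h := cl_add hX f i (Y.incl S) (by
    refine ⟨?_, fun y => ?_⟩
    · rintro (a | a) (b | b) h
      · exact congrArg _ (hi.1 h)
      · exact hS.elim b
      · exact hS.elim a
      · exact hS.elim a
    · obtain ⟨a, rfl⟩ := hi.2 y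
      exact ⟨.inl a, rfl⟩)
  rw [h, cl_of_isEmpty _ _ hS, add_zero]

theorem cl_congr {Y Y' X : SmoothSet E} {f : Y →[G] X} {f' : Y' →[G] X} (hX : X.IsTransitive)
    (i : Y' →[G] Y) (hi : Function.Bijective i) (h : ∀ y, f (i y) = f' y) :
    cl f' hX = cl f hX := by
  rw [← cl_comp_bijective f hX i hi]
  congr 1
  ext y
  exact (h y).symm

/-- The union of the images of finitely many maps. -/
def unionRange {J : Type*} {Y : SmoothSet E} {F : J → SmoothSet E} (i : ∀ j, F j →[G] Y)
    (s : Set J) : SubMulAction G Y where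
  carrier := {y | ∃ j ∈ s, ∃ z, i j z = y}
  smul_mem' := by
    rintro g _ ⟨j, hj, z, rfl⟩
    exact ⟨j, hj, g • z, map_smul _ _ _⟩

/-- Relation (b) adds one piece at a time: the induction runs over finite sets of indices and the
part of Y that their pieces cover. -/
theorem cl_eq_sum {J : Type*} [Fintype J] {Y X : SmoothSet E} (f : Y →[G] X)
    (hX : X.IsTransitive) (F : J → SmoothSet E) (i : ∀ j, F j →[G] Y)
    (hi : Function.Bijective (fun q : Σ j, F j => i q.1 q.2)) :
    cl f hX = ∑ j, cl (f.comp (i j)) hX := by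
  classical
  have key : ∀ s : Finset J, cl (f.comp (Y.incl (unionRange i s))) hX =
      ∑ j ∈ s, cl (f.comp (i j)) hX := by
    intro s
    induction s using Finset.induction_on with
    | empty =>
      rw [Finset.sum_empty]
      refine cl_of_isEmpty _ _ ⟨?_⟩
      rintro ⟨_, j, hj, -⟩
      simp at hj
    | insert a s ha ih =>
      rw [Finset.sum_insert ha, ← ih]
      let i₁ : F a →[G] Y.sub (unionRange i (insert a s : Finset J)) :=
        { toFun := fun z => ⟨i a z, a, by simp, z, rfl⟩
          map_smul' := fun g z => Subtype.ext (map_smul (i a) g z) }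
      let i₂ : Y.sub (unionRange i s) →[G] Y.sub (unionRange i (insert a s : Finset J)) :=
        { toFun := fun z => ⟨z.1, by
            obtain ⟨j, hj, h⟩ := z.2
            exact ⟨j, by simp at hj ⊢; exact .inr hj, h⟩⟩
          map_smul' := fun g z => rfl }
      refine cl_add hX _ i₁ i₂ ⟨?_, ?_⟩
      · rintro (z | ⟨z, j, hj, z', rfl⟩) (w | ⟨w, k, hk, w', rfl⟩) h
        · have := @hi.1 ⟨a, z⟩ ⟨a, w⟩ (congrArg Subtype.val h)
          simp at this
          rw [this]
        · have := @hi.1 ⟨a, z⟩ ⟨k, w'⟩ (congrArg Subtype.val h)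
          simp at this
          exact absurd (this.1 ▸ hk) ha
        · have := @hi.1 ⟨j, z'⟩ ⟨a, w⟩ (congrArg Subtype.val h)
          simp at this
          exact absurd (this.1 ▸ hj) ha
        · have h' := congrArg Subtype.val h
          exact congrArg _ (Subtype.ext h')
      · rintro ⟨_, j, hj, z, rfl⟩
        rcases Finset.mem_insert.1 (Finset.mem_coe.1 hj) with rfl | hj
        · exact ⟨.inl z, rfl⟩
        · exact ⟨.inr ⟨_, j, hj, z, rfl⟩, rfl⟩
  rw [← key Finset.univ, cl_comp_bijective]
  refine ⟨Subtype.val_injective, fun y => ?_⟩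
  obtain ⟨⟨j, z⟩, h⟩ := hi.2 y
  exact ⟨⟨y, j, by simp, z, h⟩, rfl⟩

/-- A pair of smooth sets, as a family. -/
def boolFamily (Y₁ Y₂ : SmoothSet E) : Bool → SmoothSet E
  | true => Y₁
  | false => Y₂

/-- A pair of maps, as a family. -/
def boolMap {Y Y₁ Y₂ : SmoothSet E} (i₁ : Y₁ →[G] Y) (i₂ : Y₂ →[G] Y) :
    ∀ b, boolFamily Y₁ Y₂ b →[G] Y
  | true => i₁
  | false => i₂

theorem boolMap_bijective {Y Y₁ Y₂ : SmoothSet E} {i₁ : Y₁ →[G] Y} {i₂ : Y₂ →[G] Y}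
    (hi : Function.Bijective (Sum.elim i₁ i₂)) :
    Function.Bijective (fun q : Σ b, boolFamily Y₁ Y₂ b => boolMap i₁ i₂ q.1 q.2) := by
  constructor
  · rintro ⟨_ | _, y⟩ ⟨_ | _, z⟩ h
    · obtain rfl := Sum.inr_injective (@hi.1 (.inr y) (.inr z) h)
      rfl
    · have := @hi.1 (.inr y) (.inl z) h
      simp at this
    · have := @hi.1 (.inl y) (.inr z) h
      simp at this
    · obtain rfl := Sum.inl_injective (@hi.1 (.inl y) (.inl z) h)
      rfl
  · intro y
    obtain ⟨z | z, h⟩ := hi.2 y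
    · exact ⟨⟨true, z⟩, h⟩
    · exact ⟨⟨false, z⟩, h⟩

/-- A fibre of an invariant function. -/
def fiberSub {J : Type*} (Y : SmoothSet E) (π : Y → J) (hπ : ∀ (g : G) y, π (g • y) = π y)
    (j : J) : SubMulAction G Y where
  carrier := {y | π y = j}
  smul_mem' g y hy := (hπ g y).trans hy

theorem cl_eq_sum_fiber {J : Type*} [Fintype J] {Y X : SmoothSet E} (f : Y →[G] X)
    (hX : X.IsTransitive) (π : Y → J) (hπ : ∀ (g : G) y, π (g • y) = π y) :
    cl f hX = ∑ j, cl (f.comp (Y.incl (fiberSub Y π hπ j))) hX := by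
  refine cl_eq_sum f hX _ _ ⟨?_, fun y => ⟨⟨π y, y, rfl⟩, rfl⟩⟩
  rintro ⟨j, y, hy⟩ ⟨k, z, hz⟩ h
  obtain rfl : y = z := h
  obtain rfl : π y = j := hy
  obtain rfl : π y = k := hz
  rfl

/-- An orbit of a smooth set. -/
def orbitSub (Y : SmoothSet E) (o : MulAction.orbitRel.Quotient G Y) : SubMulAction G Y :=
  fiberSub Y (fun y => (Quotient.mk _ y : MulAction.orbitRel.Quotient G Y))
    (fun g _ => Quotient.sound ⟨g, rfl⟩) o

theorem orbitSub_isTransitive (Y : SmoothSet E) (o : MulAction.orbitRel.Quotient G Y) :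
    (Y.sub (orbitSub Y o)).IsTransitive := by
  obtain ⟨y, rfl⟩ := Quotient.exists_rep o
  refine ⟨⟨⟨y, rfl⟩⟩, ⟨?_⟩⟩
  rintro ⟨a, ha⟩ ⟨b, hb⟩
  obtain ⟨g, hg⟩ := Quotient.exact (hb.trans ha.symm)
  exact ⟨g, Subtype.ext hg⟩

noncomputable instance (Y : SmoothSet E) : Fintype (MulAction.orbitRel.Quotient G Y) :=
  have := Y.finitary
  Fintype.ofFinite _

theorem cl_eq_sum_orbits {Y X : SmoothSet E} (f : Y →[G] X) (hX : X.IsTransitive) :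
    cl f hX = ∑ o, cl (f.comp (Y.incl (orbitSub Y o))) hX :=
  cl_eq_sum_fiber f hX _ _

/-- Splitting Z into orbits removes the transitivity of Z from relation (c). -/
theorem cl_comp {Z Y X : SmoothSet E} (hY : Y.IsTransitive)
    (hX : X.IsTransitive) (g : Z →[G] Y) (f : Y →[G] X) :
    cl (f.comp g) hX = cl f hX * cl g hY := by
  rw [cl_eq_sum_orbits, cl_eq_sum_orbits g, Finset.mul_sum]
  refine Finset.sum_congr rfl fun o _ => ?_
  rw [← cl_comp_of_isTransitive (orbitSub_isTransitive Z o) hY hX]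
  rfl

/-- Over each orbit of Z the set P is a base change of f to a transitive set, so relations (d) and
(c) apply orbit by orbit. -/
theorem cl_fiberProduct {P Y Z X : SmoothSet E} (hX : X.IsTransitive)
    (f : Y →[G] X) (g : Z →[G] X) (a : P →[G] Y) (b : P →[G] Z) (comm : ∀ q, f (a q) = g (b q))
    (cart : ∀ y z, f y = g z → ∃! q, a q = y ∧ b q = z) :
    cl (g.comp b) hX = cl f hX * cl g hX := by
  rw [cl_eq_sum_orbits g, Finset.mul_sum, cl_eq_sum_fiber (g.comp b) hX
    (fun q => (Quotient.mk _ (b q) : MulAction.orbitRel.Quotient G Z))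
    (fun c q => Quotient.sound ⟨c, (map_smul b c q).symm⟩)]
  refine Finset.sum_congr rfl fun o _ => ?_
  let b' : P.sub (fiberSub P (fun q => (Quotient.mk _ (b q) : MulAction.orbitRel.Quotient G Z))
      (fun c q => Quotient.sound ⟨c, (map_smul b c q).symm⟩) o) →[G] Z.sub (orbitSub Z o) :=
    { toFun := fun q => ⟨b q.1, q.2⟩
      map_smul' := fun c q => Subtype.ext (map_smul b c q.1) }
  have h1 := cl_comp (orbitSub_isTransitive Z o) hX b' (g.comp (Z.incl (orbitSub Z o)))
  have h2 := cl_baseChange hX (orbitSub_isTransitive Z o) f (g.comp (Z.incl (orbitSub Z o))) b'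
    (a.comp (P.incl _)) (fun q => comm q.1) (by
      rintro y ⟨z, hz⟩ h
      obtain ⟨q, ⟨hq, hq'⟩, hu⟩ := cart y z h
      subst hq'
      refine ⟨⟨q, hz⟩, ⟨hq, rfl⟩, ?_⟩
      rintro ⟨r, hr⟩ ⟨h3, h4⟩
      exact Subtype.ext (hu r ⟨h3, congrArg Subtype.val h4⟩))
  rw [h2, mul_comm, ← h1]
  rfl

end Classes

/-! ### Products and fibre products of smooth sets -/

section Products

variable {G : Type u} [Group G] {E : Set (Subgroup G)}

/-- Products of two `ℰ`-smooth sets are `ℰ`-smooth. -/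
structure ProdClosed (E : Set (Subgroup G)) : Prop where
  finite_orbits : ∀ Y Z : SmoothSet E, Finite (MulAction.orbitRel.Quotient G (Y × Z))
  inf_mem : ∀ U ∈ E, ∀ V ∈ E, U ⊓ V ∈ E

/-- The product of two smooth sets. -/
def SmoothSet.prod (hE : ProdClosed E) (Y Z : SmoothSet E) : SmoothSet E where
  carrier := Y × Z
  finitary := hE.finite_orbits Y Z
  smooth q := by
    have : MulAction.stabilizer G q = MulAction.stabilizer G q.1 ⊓ MulAction.stabilizer G q.2 := by
      ext g
      simp [Prod.ext_iff, MulAction.mem_stabilizer_iff]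
    rw [this]
    exact hE.inf_mem _ (Y.smooth _) _ (Z.smooth _)

/-- An embedding into an iterated binary product suffices, because smoothness passes to stable
subsets. -/
theorem ProdClosed.exists_tuples_injective (hE : ProdClosed E) (Y : SmoothSet E) (n : ℕ) :
    ∃ (Q : SmoothSet E) (i : (Fin (n + 1) → Y) →[G] Q), Function.Injective i := by
  induction n with
  | zero =>
    refine ⟨Y, ⟨fun t => t 0, fun _ _ => rfl⟩, fun s t h => ?_⟩
    funext k
    obtain rfl : k = 0 := Fin.ext (by omega)
    exact h
  | succ n ih =>
    obtain ⟨Q, i, hi⟩ := ih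
    refine ⟨Y.prod hE Q, ⟨fun t => (t 0, i (fun k => t k.succ)), fun g t => ?_⟩, fun s t h => ?_⟩
    · exact Prod.ext rfl (map_smul i g _)
    · funext k
      refine Fin.cases ?_ (fun k => ?_) k
      · exact congrArg Prod.fst h
      · exact congrFun (hi (congrArg Prod.snd h)) k

theorem ProdClosed.exists_pow_injective (hE : ProdClosed E) (Y : SmoothSet E) (p : ℕ) [NeZero p] :
    ∃ (Q : SmoothSet E) (i : (ZMod p → Y) →[G] Q), Function.Injective i := by
  obtain ⟨n, rfl⟩ := Nat.exists_eq_succ_of_ne_zero (NeZero.ne p)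
  exact hE.exists_tuples_injective Y n

/-- The smooth set of cyclic `p`-tuples in a smooth set. -/
def SmoothSet.pow (hE : ProdClosed E) (Y : SmoothSet E) (p : ℕ) [NeZero p] : SmoothSet E where
  carrier := ZMod p → Y
  finitary := by
    obtain ⟨Q, i, hi⟩ := hE.exists_pow_injective Y p
    exact (Q.ofInjective i hi).finitary
  smooth t := by
    obtain ⟨Q, i, hi⟩ := hE.exists_pow_injective Y p
    exact (Q.ofInjective i hi).smooth t

/-- The fibre product of two smooth sets. -/
def SmoothSet.fiberProd (hE : ProdClosed E) {Y Z X : SmoothSet E} (f : Y →[G] X) (g : Z →[G] X) :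
    SmoothSet E :=
  (Y.prod hE Z).sub (fiberProduct f g)

/-- `P`, with the maps `h` to `X` and `a i` to `F i`, is the fibre product of the `F i` over `X`. -/
def IsFiberProd {ι : Type*} {P X : SmoothSet E} {F : ι → SmoothSet E} (h : P →[G] X)
    (f : ∀ i, F i →[G] X) (a : ∀ i, P →[G] F i) : Prop :=
  (∀ i q, f i (a i q) = h q) ∧
    ∀ x (t : ∀ i, F i), (∀ i, f i (t i) = x) → ∃! q, h q = x ∧ ∀ i, a i q = t i

theorem exists_isFiberProd (hE : ProdClosed E) {X : SmoothSet E} (hX : X.IsTransitive) (n : ℕ) :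
    ∀ (F : Fin n → SmoothSet E) (f : ∀ i, F i →[G] X),
      ∃ (P : SmoothSet E) (h : P →[G] X) (a : ∀ i, P →[G] F i),
        IsFiberProd h f a ∧ cl h hX = ∏ i, cl (f i) hX := by
  induction n with
  | zero =>
    intro F f
    refine ⟨X, MulActionHom.id G, fun i => i.elim0, ⟨fun i => i.elim0, fun x t _ => ?_⟩, ?_⟩
    · exact ⟨x, ⟨rfl, fun i => i.elim0⟩, fun y hy => hy.1⟩
    · rw [cl_of_bijective _ _ Function.bijective_id]
      simp
  | succ n ih =>
    intro F f
    obtain ⟨P, h, a, ⟨h1, h2⟩, h3⟩ := ih (fun i => F i.succ) (fun i => f i.succ)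
    let Q := SmoothSet.fiberProd hE (f 0) h
    let b : Q →[G] F 0 := ⟨fun q => q.1.1, fun _ _ => rfl⟩
    let c : Q →[G] P := ⟨fun q => q.1.2, fun _ _ => rfl⟩
    have hbc : ∀ q, f 0 (b q) = h (c q) := fun q => q.2
    refine ⟨Q, h.comp c, Fin.cons (α := fun i => Q →[G] F i) b (fun i => (a i).comp c), ⟨?_, ?_⟩, ?_⟩
    · intro i q
      refine Fin.cases ?_ (fun k => ?_) i
      · exact hbc q
      · exact h1 k (c q)
    · intro x t ht
      obtain ⟨q, ⟨h4, h5⟩, h6⟩ := h2 x (fun i => t i.succ) (fun i => ht i.succ)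
      refine ⟨⟨(t 0, q), (ht 0).trans h4.symm⟩, ⟨h4, ?_⟩, ?_⟩
      · intro i
        refine Fin.cases rfl (fun k => ?_) i
        exact h5 k
      · rintro ⟨⟨y, r⟩, hr⟩ ⟨h7, h8⟩
        have h9 : r = q := h6 r ⟨h7, fun i => h8 i.succ⟩
        have h10 : y = t 0 := h8 0
        subst h9 h10
        rfl
    · rw [Fin.prod_univ_succ, ← h3]
      refine cl_fiberProduct hX (f 0) h b c hbc fun y z hyz => ?_
      refine ⟨⟨(y, z), hyz⟩, ⟨rfl, rfl⟩, ?_⟩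
      rintro ⟨⟨y', z'⟩, hr⟩ ⟨h7, h8⟩
      obtain rfl : y' = y := h7
      obtain rfl : z' = z := h8
      rfl

/-- The universal property identifies any fibre product with the iterated binary one of
`exists_isFiberProd`, whose class is known. -/
theorem cl_eq_prod_fin (hE : ProdClosed E) {X P : SmoothSet E} (hX : X.IsTransitive) {n : ℕ}
    {F : Fin n → SmoothSet E} {f : ∀ i, F i →[G] X} {h : P →[G] X} {a : ∀ i, P →[G] F i}
    (H : IsFiberProd h f a) : cl h hX = ∏ i, cl (f i) hX := by
  obtain ⟨P', h', a', H', e⟩ := exists_isFiberProd hE hX n F f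
  rw [← e]
  choose s hs hu using fun q : P => H'.2 (h q) (fun i => a i q) (fun i => H.1 i q)
  refine cl_congr hX ⟨s, fun g q => ?_⟩ ⟨fun q r hqr => ?_, fun q' => ?_⟩ fun q => (hs q).1
  · refine (hu (g • q) (g • s q) ⟨?_, fun i => ?_⟩).symm
    · rw [map_smul, map_smul, (hs q).1]
    · rw [map_smul, map_smul, (hs q).2]
  · change s q = s r at hqr
    refine (H.2 (h q) (fun i => a i q) (fun i => H.1 i q)).unique ⟨rfl, fun _ => rfl⟩ ⟨?_, ?_⟩
    · rw [← (hs q).1, ← (hs r).1, hqr]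
    · intro i
      rw [← (hs q).2, ← (hs r).2, hqr]
  · obtain ⟨q, ⟨h1, h2⟩, -⟩ := H.2 (h' q') (fun i => a' i q') (fun i => H'.1 i q')
    exact ⟨q, (hu q q' ⟨h1.symm, fun i => (h2 i).symm⟩).symm⟩

theorem cl_eq_prod (hE : ProdClosed E) {X P : SmoothSet E} (hX : X.IsTransitive) {p : ℕ} [NeZero p]
    {F : ZMod p → SmoothSet E} {f : ∀ i, F i →[G] X} {h : P →[G] X} {a : ∀ i, P →[G] F i}
    (H : IsFiberProd h f a) : cl h hX = ∏ i, cl (f i) hX := by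
  obtain ⟨n, rfl⟩ := Nat.exists_eq_succ_of_ne_zero (NeZero.ne p)
  -- `ZMod (n + 1)` unfolds to `Fin (n + 1)`.
  exact cl_eq_prod_fin hE hX (n := n + 1) H

end Products

/-! ### Stabilizers of finite sets: products, and the effect of `IND(m)` -/

section StabClass

variable {G : Type u} [Group G] {Ω : Type u} [MulAction G Ω]

/-- If A and B are finite sets whose pointwise stabilizers are those of y and z, with enumerations a
and b, then the orbit of (y, gz) depends only on the orbit of the concatenated tuple (a, gb), and
there are finitely many of these. -/
theorem finite_range_orbit_pair (hG : IsOligomorphic G Ω) {Y Z : SmoothSet (stabClass G Ω)}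
    (y : Y) (z : Z) :
    (Set.range fun g : G => (Quotient.mk _ (y, g • z) :
      MulAction.orbitRel.Quotient G (Y × Z))).Finite := by
  obtain ⟨A, hA⟩ := Y.smooth y
  obtain ⟨B, hB⟩ := Z.smooth z
  let a : Fin A.card → Ω := fun i => A.equivFin.symm i
  let b : Fin B.card → Ω := fun i => B.equivFin.symm i
  let φ : G → MulAction.orbitRel.Quotient G (Fin (A.card + B.card) → Ω) :=
    fun g => Quotient.mk _ (Fin.append a (g • b))
  have := hG (A.card + B.card)
  have key : Function.FactorsThrough (fun g : G => (Quotient.mk _ (y, g • z) :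
      MulAction.orbitRel.Quotient G (Y × Z))) φ := by
    intro g g' h
    obtain ⟨k, hk⟩ := Quotient.exact h
    have hka : k ∈ MulAction.stabilizer G y := by
      rw [hA, mem_fixingSubgroup_iff]
      intro x hx
      have := congrFun hk (Fin.castAdd _ (A.equivFin ⟨x, hx⟩))
      simpa [a] using this
    have hkb : g⁻¹ * (k * g') ∈ MulAction.stabilizer G z := by
      rw [hB, mem_fixingSubgroup_iff]
      intro x hx
      have := congrFun hk (Fin.natAdd _ (B.equivFin ⟨x, hx⟩))
      simp [b] at this
      rw [mul_smul, mul_smul, this, inv_smul_smul]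
    refine Quotient.sound ⟨k, Prod.ext hka ?_⟩
    have h2 : (g⁻¹ * (k * g')) • z = z := hkb
    rw [mul_smul, mul_smul, inv_smul_eq_iff] at h2
    exact h2
  -- The range is that of a function on the finite set of orbits of tuples; its default value off
  -- the image of `φ` plays no role.
  refine (Set.finite_range (Function.extend φ (fun g : G => (Quotient.mk _ (y, g • z) :
      MulAction.orbitRel.Quotient G (Y × Z))) (fun _ => Quotient.mk _ (y, z)))).subset ?_
  rintro _ ⟨g, rfl⟩
  exact ⟨φ g, key.extend_apply _ g⟩

theorem prodClosed_stabClass (hG : IsOligomorphic G Ω) : ProdClosed (stabClass G Ω) where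
  finite_orbits Y Z := by
    -- Every orbit on Y × Z contains a pair (y₀, g z₀) with y₀ and z₀ among the finitely many chosen
    -- orbit representatives.
    have hf : (⋃ o : MulAction.orbitRel.Quotient G Y × MulAction.orbitRel.Quotient G Z,
        Set.range fun g : G => (Quotient.mk _ (o.1.out, g • o.2.out) :
          MulAction.orbitRel.Quotient G (Y × Z))).Finite :=
      Set.finite_iUnion fun o => finite_range_orbit_pair hG _ _
    refine Set.finite_univ_iff.1 (hf.subset ?_)
    rintro ⟨y, z⟩ -
    obtain ⟨g, hg⟩ := Quotient.exact (Quotient.out_eq (Quotient.mk _ y :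
      MulAction.orbitRel.Quotient G Y))
    obtain ⟨k, hk⟩ := Quotient.exact (Quotient.out_eq (Quotient.mk _ z :
      MulAction.orbitRel.Quotient G Z))
    refine Set.mem_iUnion.2 ⟨(Quotient.mk _ y, Quotient.mk _ z), g * k⁻¹, ?_⟩
    refine Quotient.sound ⟨g, Prod.ext hg ?_⟩
    dsimp only at hk ⊢
    rw [← hk, smul_smul, inv_mul_cancel_right]
    rfl
  inf_mem := by
    classical
    rintro _ ⟨A, rfl⟩ _ ⟨B, rfl⟩
    exact ⟨A ∪ B, by rw [Finset.coe_union, fixingSubgroup_union]⟩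

/-- A cyclic `p`-tuple is conjugate to a proper rotation of itself only if it is constant. -/
def RotFree (E : Set (Subgroup G)) (p : ℕ) : Prop :=
  ∀ (Y : SmoothSet E) (t : ZMod p → Y) (g : G) (j : ZMod p), j ≠ 0 →
    (∀ i, g • t i = t (i + j)) → ∀ i, t i = t 0

/-- The pointwise stabilizer is normal in the setwise one, so the power of g with exponent the index
lies in it, and the index divides some m^k. -/
theorem pow_mem_fixingSubgroup_of_IND {m : ℕ} (hind : IND G Ω m) {A : Finset Ω} {g : G}
    (hg : g ∈ MulAction.stabilizer G (A : Set Ω)) :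
    ∃ k, g ^ m ^ k ∈ fixingSubgroup G (A : Set Ω) := by
  obtain ⟨k, d, hk⟩ := hind A
  refine ⟨k, ?_⟩
  let H := (fixingSubgroup G (A : Set Ω)).subgroupOf (MulAction.stabilizer G (A : Set Ω))
  have hn : H.Normal := by
    refine ⟨fun n hn c => ?_⟩
    simp only [H, Subgroup.mem_subgroupOf, mem_fixingSubgroup_iff] at hn ⊢
    intro y hy
    have h1 : (c⁻¹ : G) • y ∈ (A : Set Ω) := by
      have := (MulAction.stabilizer G (A : Set Ω)).inv_mem c.2
      rw [MulAction.mem_stabilizer_iff] at this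
      exact this.subset (Set.smul_mem_smul_set hy)
    simp [mul_smul, hn _ h1]
  have h1 := H.pow_index_mem ⟨g, hg⟩
  rw [hk, pow_mul]
  exact Subgroup.pow_mem _ (Subgroup.mem_subgroupOf.1 h1) d

/-- If g rotates t by j, then g^p fixes t 0, hence fixes pointwise a finite B supporting t 0. The
union A of the translates of B by powers of g is g-stable and g^p fixes it pointwise; so does some
g^(m^k) by `IND(m)`. As p is prime to m, g itself fixes A pointwise, hence t 0, and then t is
constant because j generates ℤ/p. -/
theorem rotFree_stabClass {m : ℕ} (hind : IND G Ω m) {p : ℕ} (hp : p.Prime)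
    (hpm : ¬ p ∣ m) : RotFree (stabClass G Ω) p := by
  classical
  intro Y t g j hj h
  have : Fact p.Prime := ⟨hp⟩
  have hk : ∀ (k : ℕ) i, g ^ k • t i = t (i + k * j) := by
    intro k
    induction k with
    | zero => simp
    | succ k ih =>
      intro i
      rw [pow_succ', mul_smul, ih, h]
      push_cast
      ring_nf
  obtain ⟨B, hB⟩ := Y.smooth (t 0)
  have hgp : ∀ b ∈ B, g ^ p • b = b := by
    have h1 : g ^ p ∈ MulAction.stabilizer G (t 0) := by
      rw [MulAction.mem_stabilizer_iff, hk]
      simp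
    rw [hB, mem_fixingSubgroup_iff] at h1
    exact h1
  let A : Finset Ω := (Finset.range p).biUnion fun k => B.image fun b => g ^ k • b
  have hA : ∀ x ∈ A, ∃ k < p, ∃ b ∈ B, g ^ k • b = x := by
    intro x hx
    simpa [A] using hx
  have hBA : ∀ b ∈ B, b ∈ A := by
    intro b hb
    simp only [A, Finset.mem_biUnion, Finset.mem_image, Finset.mem_range]
    exact ⟨0, hp.pos, b, hb, by simp⟩
  have h1 : g ^ p ∈ fixingSubgroup G (A : Set Ω) := by
    rw [mem_fixingSubgroup_iff]
    intro x hx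
    obtain ⟨k, -, b, hb, rfl⟩ := hA x hx
    rw [smul_smul, ← pow_add, add_comm, pow_add, mul_smul, hgp b hb]
  have h2 : g ∈ MulAction.stabilizer G (A : Set Ω) := by
    rw [MulAction.mem_stabilizer_set_iff_smul_set_subset A.finite_toSet]
    rintro _ ⟨x, hx, rfl⟩
    obtain ⟨k, hkp, b, hb, rfl⟩ := hA x hx
    dsimp only
    rw [smul_smul, ← pow_succ']
    rcases Nat.lt_or_ge (k + 1) p with h3 | h3
    · simp only [A, Finset.coe_biUnion, Set.mem_iUnion, Finset.coe_image, Finset.mem_coe,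
        Finset.mem_range, Set.mem_image]
      exact ⟨k + 1, h3, b, hb, rfl⟩
    · obtain rfl : p = k + 1 := by omega
      rw [hgp b hb]
      exact hBA b hb
  obtain ⟨k, hk'⟩ := pow_mem_fixingSubgroup_of_IND hind h2
  have h3 : g ∈ fixingSubgroup G (A : Set Ω) := by
    -- Bézout: g is a product of powers of g^p and g^(m^k).
    have hc : IsCoprime (p : ℤ) ((m ^ k : ℕ) : ℤ) :=
      Nat.isCoprime_iff_coprime.2 (((Nat.Prime.coprime_iff_not_dvd hp).2 hpm).pow_right k)
    obtain ⟨u, v, huv⟩ := hc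
    have : g = (g ^ p) ^ u * (g ^ m ^ k) ^ v := by
      rw [← zpow_natCast, ← zpow_natCast, ← zpow_mul, ← zpow_mul, ← zpow_add, mul_comm, mul_comm _ v,
        huv, zpow_one]
    rw [this]
    exact mul_mem (zpow_mem h1 u) (zpow_mem hk' v)
  have h4 : g • t 0 = t 0 := by
    rw [← MulAction.mem_stabilizer_iff, hB, mem_fixingSubgroup_iff]
    intro b hb
    exact (mem_fixingSubgroup_iff G).1 h3 b (hBA b hb)
  have h5 : ∀ k : ℕ, g ^ k • t 0 = t 0 := fun k =>
    (MulAction.stabilizer G (t 0)).pow_mem h4 k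
  intro i
  rw [← h5 (i * j⁻¹).val, hk]
  congr 1
  rw [ZMod.natCast_zmod_val, inv_mul_cancel_right₀ hj, zero_add]

end StabClass

/-! ### Rotations of cyclic tuples and transversals -/

section Rotation

variable {p : ℕ}

/-- The rotation of a cyclic tuple by `j` places. -/
def rot {Y : Type*} (j : ZMod p) (t : ZMod p → Y) : ZMod p → Y := fun i => t (i + j)

@[simp] theorem rot_apply {Y : Type*} (j : ZMod p) (t : ZMod p → Y) (i : ZMod p) :
    rot j t i = t (i + j) := rfl

theorem rot_rot {Y : Type*} (j k : ZMod p) (t : ZMod p → Y) : rot j (rot k t) = rot (j + k) t := by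
  funext i
  simp [add_assoc]

@[simp] theorem rot_zero {Y : Type*} (t : ZMod p → Y) : rot 0 t = t := by
  funext i
  simp

/-- `T` is a transversal for the rotations in the set `N` of cyclic tuples. -/
structure IsTransversal {H Y : Type*} [Group H] [MulAction H Y]
    (N T : SubMulAction H (ZMod p → Y)) : Prop where
  rot_mem : ∀ t ∈ N, ∀ j, rot j t ∈ N
  mem : ∀ t ∈ T, t ∈ N
  existsUnique : ∀ t ∈ N, ∃! j, rot j t ∈ T

theorem IsTransversal.eq_zero {H Y : Type*} [Group H] [MulAction H Y]
    {N T : SubMulAction H (ZMod p → Y)} (hT : IsTransversal N T) {t : ZMod p → Y} (ht : t ∈ T)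
    {j : ZMod p} (hj : rot j t ∈ T) : j = 0 :=
  (hT.existsUnique t (hT.mem t ht)).unique hj (by rwa [rot_zero])

/-- Choose one representative in each class under H and rotations together, and let T consist of the
tuples in N that are H-conjugate to the representative of their class. Freeness makes the rotation
into T unique. -/
theorem exists_isTransversal {H Y : Type*} [Group H] [MulAction H Y]
    (N : SubMulAction H (ZMod p → Y)) (hN : ∀ t ∈ N, ∀ j, rot j t ∈ N)
    (free : ∀ t ∈ N, ∀ (g : H) j, g • t = rot j t → j = 0) : ∃ T, IsTransversal N T := by
  let r : Setoid (ZMod p → Y) :=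
    { r := fun s t => ∃ (g : H) (j : ZMod p), g • s = rot j t
      iseqv := by
        refine ⟨fun t => ⟨1, 0, by simp⟩, ?_, ?_⟩
        · rintro s t ⟨g, j, h⟩
          refine ⟨g⁻¹, -j, ?_⟩
          rw [inv_smul_eq_iff]
          change t = rot (-j) (g • s)
          rw [h, rot_rot, neg_add_cancel, rot_zero]
        · rintro s t w ⟨g, j, h⟩ ⟨g', j', h'⟩
          refine ⟨g' * g, j + j', ?_⟩
          rw [mul_smul, h]
          change rot j (g' • t) = _
          rw [h', rot_rot] }
  let T : SubMulAction H (ZMod p → Y) :=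
    { carrier := {t | t ∈ N ∧ ∃ g : H, g • t = (Quotient.mk r t).out}
      smul_mem' := by
        rintro c t ⟨ht, g, hg⟩
        refine ⟨N.smul_mem c ht, g * c⁻¹, ?_⟩
        have : Quotient.mk r (c • t) = Quotient.mk r t := Quotient.sound ⟨c⁻¹, 0, by simp⟩
        rw [this, mul_smul, inv_smul_smul, hg] }
  refine ⟨T, hN, fun t ht => ht.1, fun t ht => ?_⟩
  have hrot : ∀ j, Quotient.mk r (rot j t) = Quotient.mk r t := fun j =>
    Quotient.sound ⟨1, j, by simp⟩
  obtain ⟨g, j, h⟩ := Quotient.exact (Quotient.out_eq (Quotient.mk r t))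
  refine ⟨j, ⟨hN t ht j, g⁻¹, ?_⟩, ?_⟩
  · rw [hrot, inv_smul_eq_iff, h]
  · rintro k ⟨-, g', h'⟩
    rw [hrot] at h'
    have : (g * g') • rot k t = rot j t := by rw [mul_smul, h', h]
    have h0 := free (rot k t) (hN t ht k) (g * g') (j - k) (by
      rw [this, rot_rot, sub_add_cancel])
    exact (sub_eq_zero.1 h0).symm

/-- For p prime a nonzero j generates ℤ/p, so a tuple fixed by rotation by j is constant. -/
theorem eq_zero_of_rot_eq [Fact p.Prime] {Y : Type*} {t : ZMod p → Y} (ht : ∃ i, t i ≠ t 0)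
    {j : ZMod p} (h : rot j t = t) : j = 0 := by
  by_contra hj
  obtain ⟨i, hi⟩ := ht
  apply hi
  have : ∀ k : ℕ, t (k * j) = t 0 := by
    intro k
    induction k with
    | zero => simp
    | succ k ih =>
      rw [← ih]
      nth_rewrite 2 [← h]
      rw [rot_apply]
      push_cast
      ring_nf
  have h2 := this (i * j⁻¹).val
  rwa [ZMod.natCast_zmod_val, inv_mul_cancel_right₀ hj] at h2

/-- The nonconstant cyclic words in two letters, up to rotation. -/
theorem exists_word_transversal (p : ℕ) [Fact p.Prime] :
    ∃ W : Finset (ZMod p → Bool), (∀ w ∈ W, ∃ i, w i ≠ w 0) ∧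
      ∀ w : ZMod p → Bool, (∃ i, w i ≠ w 0) → ∃! j, rot j w ∈ W := by
  classical
  -- With the trivial group acting, a transversal is one for the rotations alone.
  let N : SubMulAction (⊥ : Subgroup (Equiv.Perm Bool)) (ZMod p → Bool) :=
    { carrier := {w | ∃ i, w i ≠ w 0}
      smul_mem' := by
        rintro ⟨g, hg⟩ w hw
        obtain rfl := Subgroup.mem_bot.1 hg
        exact hw }
  obtain ⟨T, h1, h2, h3⟩ := exists_isTransversal N (by
    rintro w ⟨i, hi⟩ j
    by_contra h
    have h' : ∀ i, w (i + j) = w (0 + j) := by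
      intro i
      by_contra h5
      exact h ⟨i, h5⟩
    have h4 := h' (i - j)
    have h5 := h' (0 - j)
    rw [sub_add_cancel] at h4 h5
    exact hi (h4.trans h5.symm)) (by
    rintro w hw ⟨g, hg⟩ j h
    obtain rfl := Subgroup.mem_bot.1 hg
    exact eq_zero_of_rot_eq hw h.symm)
  refine ⟨Finset.univ.filter (· ∈ T), fun w hw => h2 w (by simpa using hw), fun w hw => ?_⟩
  simpa using h3 w hw

/-- In the expansion over words, constant words give the p-th powers, and the other words fall into
rotation classes of exactly p words with equal products. Expressing the mixed terms through W lets
them match the mixed tuples in `cl_transversal_add`. -/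
theorem add_pow_eq_words {A : Type*} [CommRing A] [Fact p.Prime] {W : Finset (ZMod p → Bool)}
    (hW : ∀ w ∈ W, ∃ i, w i ≠ w 0)
    (hW' : ∀ w : ZMod p → Bool, (∃ i, w i ≠ w 0) → ∃! j, rot j w ∈ W) (a : Bool → A) :
    (a true + a false) ^ p =
      a true ^ p + a false ^ p + p * ∑ w ∈ W, ∏ i, a (w i) := by
  classical
  have h1 : (a true + a false) ^ p = ∑ w : ZMod p → Bool, ∏ i, a (w i) := by
    have := Finset.prod_univ_sum (fun _ : ZMod p => (Finset.univ : Finset Bool))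
      (fun _ b => a b)
    rw [Fintype.piFinset_univ] at this
    simpa only [Fintype.sum_bool, Finset.prod_const, Finset.card_univ, ZMod.card] using this
  let φ : Bool ⊕ (W × ZMod p) → (ZMod p → Bool) :=
    Sum.elim (fun b _ => b) (fun q => rot q.2 q.1.1)
  have hrot : ∀ w ∈ W, ∀ j, ∃ i, rot j w i ≠ rot j w 0 := by
    intro w hw j
    obtain ⟨i, hi⟩ := hW w hw
    by_contra! h
    have h4 := h (i - j)
    have h5 := h (0 - j)
    simp only [rot_apply, sub_add_cancel] at h4 h5
    exact hi (h4.trans h5.symm)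
  have hφ : Function.Bijective φ := by
    constructor
    · rintro (b | ⟨⟨w, hw⟩, j⟩) (c | ⟨⟨v, hv⟩, k⟩) h
      · exact congrArg _ (congrFun h 0)
      · obtain ⟨i, hi⟩ := hrot v hv k
        have h2 : (fun _ => b) = rot k v := h
        rw [← h2] at hi
        exact absurd rfl hi
      · obtain ⟨i, hi⟩ := hrot w hw j
        have h2 : rot j w = (fun _ => c) := h
        rw [h2] at hi
        exact absurd rfl hi
      · have h2 : rot j w = rot k v := h
        have h3 : rot (j - k) w = v := by
          rw [sub_eq_neg_add, ← rot_rot, h2, rot_rot, neg_add_cancel, rot_zero]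
        have h4 : j - k = 0 := (hW' w (hW w hw)).unique (by rwa [h3]) (by rwa [rot_zero])
        rw [h4, rot_zero] at h3
        obtain rfl := h3
        obtain rfl := sub_eq_zero.1 h4
        rfl
    · intro w
      by_cases hw : ∃ i, w i ≠ w 0
      · obtain ⟨j, hj, -⟩ := hW' w hw
        refine ⟨.inr (⟨_, hj⟩, -j), ?_⟩
        change rot (-j) (rot j w) = w
        rw [rot_rot, neg_add_cancel, rot_zero]
      · push Not at hw
        exact ⟨.inl (w 0), funext fun i => (hw i).symm⟩
  have hprod : ∀ (w : ZMod p → Bool) j, ∏ i, a (rot j w i) = ∏ i, a (w i) := fun w j =>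
    Fintype.prod_equiv (Equiv.addRight j) _ _ fun _ => rfl
  rw [h1, ← hφ.sum_comp, Fintype.sum_sum_type, Fintype.sum_prod_type]
  congr 1
  · simp [φ, ZMod.card]
  · simp only [φ, Sum.elim_inr, hprod]
    simp only [Finset.sum_const, Finset.card_univ, ZMod.card, nsmul_eq_mul]
    rw [← Finset.mul_sum, Finset.sum_coe_sort W (fun w => ∏ i, a (w i))]

end Rotation

/-! ### Transversals of nonconstant tuples in the fibres of a map -/

section Transversals

variable {G : Type u} [Group G] {E : Set (Subgroup G)} {p : ℕ}

/-- The nonconstant cyclic tuples in the fibres of a map. -/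
def nonconst {Y X : SmoothSet E} (f : Y →[G] X) (p : ℕ) : SubMulAction G (ZMod p → Y) where
  carrier := {t | (∀ i, f (t i) = f (t 0)) ∧ ∃ i, t i ≠ t 0}
  smul_mem' := by
    rintro g t ⟨h1, i, hi⟩
    refine ⟨fun i => ?_, i, fun h => hi (smul_left_cancel g h)⟩
    simp only [Pi.smul_apply, map_smul, h1 i]

theorem rot_mem_nonconst {Y X : SmoothSet E} (f : Y →[G] X) :
    ∀ t ∈ nonconst f p, ∀ j, rot j t ∈ nonconst f p := by
  rintro t ⟨h1, i, hi⟩ j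
  refine ⟨fun i => ?_, ?_⟩
  · rw [rot_apply, rot_apply, h1, h1 (0 + j)]
  · by_contra! h
    have h4 := h (i - j)
    have h5 := h (0 - j)
    simp only [rot_apply, sub_add_cancel] at h4 h5
    exact hi (h4.trans h5.symm)

theorem RotFree.exists_isTransversal (hr : RotFree E p) {Y X : SmoothSet E} (f : Y →[G] X) :
    ∃ T, IsTransversal (nonconst f p) T := by
  refine Oligo.exists_isTransversal _ (rot_mem_nonconst f) ?_
  rintro t ⟨-, i, hi⟩ g j h
  by_contra hj
  exact hi (hr Y t g j hj (fun i => congrFun h i) i)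

variable (hE : ProdClosed E) [Fact p.Prime]

/-- A stable set of cyclic tuples in a smooth set, as a smooth set. -/
def powSub {Y : SmoothSet E} (T : SubMulAction G (ZMod p → Y)) : SmoothSet E :=
  (Y.pow hE p).sub T

/-- The map `t ↦ f (t 0)` on a stable set of cyclic tuples. -/
def powSubMap {Y X : SmoothSet E} (f : Y →[G] X) (T : SubMulAction G (ZMod p → Y)) :
    powSub hE T →[G] X where
  toFun := fun t : T => f (t.1 0)
  map_smul' := fun g (t : T) => map_smul f g (t.1 0)

/-- Cut T into the pieces on which rotation by j leads into T'. Rotation maps each piece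
isomorphically onto a piece of T', and it preserves the map to X because all entries lie in one
fibre of f. -/
theorem cl_eq_of_isTransversal {Y X : SmoothSet E} (f : Y →[G] X) (hX : X.IsTransitive)
    {N T T' : SubMulAction G (ZMod p → Y)} (hN : ∀ t ∈ N, ∀ i, f (t i) = f (t 0))
    (hT : IsTransversal N T) (hT' : IsTransversal N T') :
    cl (powSubMap hE f T) hX = cl (powSubMap hE f T') hX := by
  let S : ZMod p → SubMulAction G (ZMod p → Y) := fun j =>
    { carrier := {t | t ∈ T ∧ rot j t ∈ T'}
      smul_mem' := fun g t ht => ⟨T.smul_mem g ht.1, T'.smul_mem g ht.2⟩ }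
  let a : ∀ j, powSub hE (S j) →[G] powSub hE T := fun j =>
    { toFun := fun t : S j => (⟨t.1, t.2.1⟩ : T)
      map_smul' := fun _ _ => rfl }
  let b : ∀ j, powSub hE (S j) →[G] powSub hE T' := fun j =>
    { toFun := fun t : S j => (⟨rot j t.1, t.2.2⟩ : T')
      map_smul' := fun _ _ => rfl }
  rw [cl_eq_sum _ hX _ a, cl_eq_sum _ hX _ b]
  · refine Finset.sum_congr rfl fun j _ => ?_
    congr 1
    ext t
    obtain ⟨t, ht⟩ : S j := t
    exact (hN t (hT.mem t ht.1) (0 + j)).symm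
  · constructor
    · rintro ⟨j, t⟩ ⟨k, s⟩ h
      obtain ⟨t, ht⟩ : S j := t
      obtain ⟨s, hs⟩ : S k := s
      have h2 : rot j t = rot k s := congrArg Subtype.val h
      have h3 : rot (j - k) t = s := by
        rw [sub_eq_neg_add, ← rot_rot, h2, rot_rot, neg_add_cancel, rot_zero]
      have h4 : j - k = 0 := hT.eq_zero ht.1 (by rw [h3]; exact hs.1)
      rw [h4, rot_zero] at h3
      obtain rfl := h3
      obtain rfl := sub_eq_zero.1 h4
      rfl
    · intro t
      obtain ⟨t, ht⟩ : T' := t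
      obtain ⟨j, hj, -⟩ := hT.existsUnique t (hT'.mem t ht)
      have h2 : rot (-j) (rot j t) = t := by rw [rot_rot, neg_add_cancel, rot_zero]
      have h3 : rot j t ∈ S (-j) := ⟨hj, by rw [h2]; exact ht⟩
      exact ⟨⟨-j, (⟨_, h3⟩ : S (-j))⟩, Subtype.ext h2⟩
  · constructor
    · rintro ⟨j, t⟩ ⟨k, s⟩ h
      obtain ⟨t, ht⟩ : S j := t
      obtain ⟨s, hs⟩ : S k := s
      obtain rfl : t = s := congrArg Subtype.val h
      obtain rfl := (hT'.existsUnique t (hT.mem t ht.1)).unique ht.2 hs.2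
      rfl
    · intro t
      obtain ⟨t, ht⟩ : T := t
      obtain ⟨j, hj, -⟩ := hT'.existsUnique t (hT.mem t ht)
      have h3 : t ∈ S j := ⟨ht, hj⟩
      exact ⟨⟨j, (⟨_, h3⟩ : S j)⟩, rfl⟩

/-- All cyclic tuples in the fibres of a map. -/
def fiberPow {Y X : SmoothSet E} (f : Y →[G] X) (p : ℕ) : SubMulAction G (ZMod p → Y) where
  carrier := {t | ∀ i, f (t i) = f (t 0)}
  smul_mem' g t h i := by simp only [Pi.smul_apply, map_smul, h i]

theorem cl_fiberPow {Y X : SmoothSet E} (f : Y →[G] X) (hX : X.IsTransitive) :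
    cl (powSubMap hE f (fiberPow f p)) hX = cl f hX ^ p := by
  let a : ∀ _ : ZMod p, powSub hE (fiberPow f p) →[G] Y := fun i =>
    { toFun := fun t : fiberPow f p => t.1 i
      map_smul' := fun _ _ => rfl }
  have H : IsFiberProd (powSubMap hE f (fiberPow f p)) (fun _ => f) a := by
    refine ⟨fun i (q : fiberPow f p) => q.2 i, fun x t ht => ?_⟩
    refine ⟨(⟨t, fun i => (ht i).trans (ht 0).symm⟩ : fiberPow f p), ⟨ht 0, fun _ => rfl⟩, ?_⟩
    rintro (q : fiberPow f p) ⟨-, h⟩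
    exact Subtype.ext (funext h)
  rw [cl_eq_prod hE hX H]
  simp [ZMod.card]

/-- The p-fold fibre power of Y over X is the diagonal, a copy of Y, together with the p rotations
of T. -/
theorem cl_pow_eq {Y X : SmoothSet E} (f : Y →[G] X) (hX : X.IsTransitive)
    {T : SubMulAction G (ZMod p → Y)} (hT : IsTransversal (nonconst f p) T) :
    cl f hX ^ p = cl f hX + p * cl (powSubMap hE f T) hX := by
  let F : Option (ZMod p) → SmoothSet E := fun o => o.elim Y fun _ => powSub hE T
  let a : ∀ o, F o →[G] powSub hE (fiberPow f p)
    | none =>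
      { toFun := fun y : Y => (⟨fun _ => y, fun _ => rfl⟩ : fiberPow f p)
        map_smul' := fun _ _ => rfl }
    | some j =>
      { toFun := fun t : T => (⟨rot j t.1, (rot_mem_nonconst f t.1 (hT.mem _ t.2) j).1⟩ :
          fiberPow f p)
        map_smul' := fun _ _ => rfl }
  rw [← cl_fiberPow hE f hX, cl_eq_sum _ hX F a, Fintype.sum_option]
  · congr 1
    rw [Finset.sum_congr rfl (g := fun _ => cl (powSubMap hE f T) hX)]
    · simp [ZMod.card]
    · intro j _
      congr 1
      ext t
      obtain ⟨t, ht⟩ : T := t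
      exact (hT.mem t ht).1 (0 + j)
  · constructor
    · rintro ⟨_ | j, t⟩ ⟨_ | k, s⟩ h
      · have h2 : (fun _ => t) = (fun _ => s) := congrArg Subtype.val h
        obtain rfl : t = s := congrFun h2 0
        rfl
      · obtain ⟨s, hs⟩ : T := s
        have h2 : (fun _ => t) = rot k s := congrArg Subtype.val h
        obtain ⟨i, hi⟩ := (rot_mem_nonconst f s (hT.mem _ hs) k).2
        rw [← h2] at hi
        exact absurd rfl hi
      · obtain ⟨t, ht⟩ : T := t
        have h2 : rot j t = (fun _ => s) := congrArg Subtype.val h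
        obtain ⟨i, hi⟩ := (rot_mem_nonconst f t (hT.mem _ ht) j).2
        rw [h2] at hi
        exact absurd rfl hi
      · obtain ⟨t, ht⟩ : T := t
        obtain ⟨s, hs⟩ : T := s
        have h2 : rot j t = rot k s := congrArg Subtype.val h
        have h3 : rot (j - k) t = s := by
          rw [sub_eq_neg_add, ← rot_rot, h2, rot_rot, neg_add_cancel, rot_zero]
        have h4 : j - k = 0 := hT.eq_zero ht (by rwa [h3])
        rw [h4, rot_zero] at h3
        obtain rfl := h3
        obtain rfl := sub_eq_zero.1 h4
        rfl
    · intro t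
      obtain ⟨t, ht⟩ : fiberPow f p := t
      by_cases hc : ∃ i, t i ≠ t 0
      · obtain ⟨j, hj, -⟩ := hT.existsUnique t ⟨ht, hc⟩
        refine ⟨⟨some (-j), (⟨_, hj⟩ : T)⟩, Subtype.ext ?_⟩
        change rot (-j) (rot j t) = t
        rw [rot_rot, neg_add_cancel, rot_zero]
      · push Not at hc
        exact ⟨⟨none, t 0⟩, Subtype.ext (funext fun i => (hc i).symm)⟩

end Transversals

/-! ### Counterparts of the relations (a)-(d) for transversals -/

section TransversalRelations

variable {G : Type u} [Group G] {E : Set (Subgroup G)} (hE : ProdClosed E) {p : ℕ} [Fact p.Prime]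

theorem cl_transversal_of_injective {Y X : SmoothSet E} (f : Y →[G] X) (hX : X.IsTransitive)
    (hf : Function.Injective f) {T : SubMulAction G (ZMod p → Y)}
    (hT : IsTransversal (nonconst f p) T) : cl (powSubMap hE f T) hX = 0 := by
  refine cl_of_isEmpty _ _ ⟨fun t => ?_⟩
  obtain ⟨t, ht⟩ : T := t
  obtain ⟨h, i, hi⟩ := hT.mem t ht
  exact hi (hf (h i))

/-- The pullback of T to tuples in Y' is a transversal for f' and also the base change of T, and the
choice of transversal does not affect the class. -/
theorem cl_transversal_baseChange {Y X Y' X' : SmoothSet E} (hX : X.IsTransitive)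
    (hX' : X'.IsTransitive) (f : Y →[G] X) (g : X' →[G] X) (f' : Y' →[G] X') (h : Y' →[G] Y)
    (comm : ∀ y', f (h y') = g (f' y'))
    (cart : ∀ (y : Y) (x' : X'), f y = g x' → ∃! y' : Y', h y' = y ∧ f' y' = x')
    {T : SubMulAction G (ZMod p → Y)} (hT : IsTransversal (nonconst f p) T)
    {T' : SubMulAction G (ZMod p → Y')} (hT' : IsTransversal (nonconst f' p) T') :
    cl (powSubMap hE f T) hX = cl (powSubMap hE f' T') hX' := by
  let U : SubMulAction G (ZMod p → Y') :=
    { carrier := {t | (∀ i, f' (t i) = f' (t 0)) ∧ (fun i => h (t i)) ∈ T}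
      smul_mem' := fun c t ht => by
        refine ⟨fun i => ?_, ?_⟩
        · simp only [Pi.smul_apply, map_smul, ht.1 i]
        · have : (fun i => h ((c • t) i)) = c • fun i => h (t i) := by
            funext i
            exact map_smul h c _
          rw [this]
          exact T.smul_mem c ht.2 }
  have hinj : ∀ y z, h y = h z → f' y = f' z → y = z := fun y z h1 h2 =>
    (cart (h z) (f' z) (comm z)).unique ⟨h1, h2⟩ ⟨rfl, rfl⟩
  have hU : IsTransversal (nonconst f' p) U := by
    refine ⟨rot_mem_nonconst f', fun t ht => ⟨ht.1, ?_⟩, fun t ht => ?_⟩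
    · obtain ⟨i, hi⟩ := (hT.mem _ ht.2).2
      exact ⟨i, fun h1 => hi (congrArg h h1)⟩
    · have h1 : (fun i => h (t i)) ∈ nonconst f p := by
        refine ⟨fun i => ?_, ?_⟩
        · rw [comm, comm, ht.1]
        · obtain ⟨i, hi⟩ := ht.2
          exact ⟨i, fun h1 => hi (hinj _ _ h1 (ht.1 i))⟩
      obtain ⟨j, hj, hj'⟩ := hT.existsUnique _ h1
      exact ⟨j, ⟨(rot_mem_nonconst f' t ht j).1, hj⟩, fun k hk => hj' k hk.2⟩
  rw [cl_eq_of_isTransversal hE f' hX' (N := nonconst f' p) (fun t ht => ht.1) hT' hU]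
  let b : powSub hE U →[G] powSub hE T :=
    { toFun := fun t : U => (⟨fun i => h (t.1 i), t.2.2⟩ : T)
      map_smul' := fun c (t : U) => Subtype.ext (funext fun i => map_smul h c (t.1 i)) }
  refine cl_baseChange hX hX' _ g _ b (fun (t : U) => comm (t.1 0)) ?_
  intro t x' hx
  obtain ⟨t, ht⟩ : T := t
  have h1 : ∀ i, f (t i) = g x' := fun i => ((hT.mem t ht).1 i).trans hx
  choose s hs hs' using fun i => cart (t i) x' (h1 i)
  have hsU : s ∈ U := by
    refine ⟨fun i => (hs i).2.trans (hs 0).2.symm, ?_⟩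
    convert ht using 1
    funext i
    exact (hs i).1
  refine ⟨(⟨s, hsU⟩ : U), ⟨Subtype.ext (funext fun i => (hs i).1), (hs 0).2⟩, ?_⟩
  intro r hr
  obtain ⟨r, hrU⟩ : U := r
  obtain ⟨h2, h3⟩ := hr
  refine Subtype.ext (funext fun i => hs' i _ ⟨?_, ?_⟩)
  · exact congrFun (congrArg Subtype.val h2) i
  · exact (hrU.1 i).trans h3

/-- V is the fibre product over O of the pullbacks of g along the p maps e i, and each pullback has
class [g] by relation (d). -/
theorem cl_eq_pow_of_cartesian (hE : ProdClosed E) {V O Y Z : SmoothSet E} (hO : O.IsTransitive) (hY : Y.IsTransitive)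
    (g : Z →[G] Y) (e : ZMod p → (O →[G] Y)) (v : V →[G] O) (b : ZMod p → (V →[G] Z))
    (comm : ∀ i q, g (b i q) = e i (v q))
    (cart : ∀ (o : O) (t : ZMod p → Z), (∀ i, g (t i) = e i o) → ∃! q, v q = o ∧ ∀ i, b i q = t i) :
    cl v hO = cl g hY ^ p := by
  let F : ZMod p → SmoothSet E := fun i => SmoothSet.fiberProd hE g (e i)
  let f : ∀ i, F i →[G] O := fun i => ⟨fun q => q.1.2, fun _ _ => rfl⟩
  let d : ∀ i, F i →[G] Z := fun i => ⟨fun q => q.1.1, fun _ _ => rfl⟩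
  let a : ∀ i, V →[G] F i := fun i =>
    { toFun := fun q => ⟨(b i q, v q), comm i q⟩
      map_smul' := fun c q => Subtype.ext (Prod.ext (map_smul (b i) c q) (map_smul v c q)) }
  have H : IsFiberProd v f a := by
    refine ⟨fun i q => rfl, fun o t ht => ?_⟩
    obtain ⟨q, ⟨h1, h2⟩, h3⟩ := cart o (fun i => d i (t i)) (fun i => by
      rw [← ht i]
      exact (t i).2)
    refine ⟨q, ⟨h1, fun i => ?_⟩, ?_⟩
    · exact Subtype.ext (Prod.ext (h2 i) (h1.trans (ht i).symm))
    · rintro r ⟨h4, h5⟩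
      refine h3 r ⟨h4, fun i => ?_⟩
      rw [← h5 i]
      rfl
  have hF : ∀ i, cl (f i) hO = cl g hY := by
    intro i
    refine (cl_baseChange hY hO g (e i) (f i) (d i) (fun q => q.2) ?_).symm
    intro z o h
    refine ⟨⟨(z, o), h⟩, ⟨rfl, rfl⟩, ?_⟩
    rintro ⟨⟨z', o'⟩, h'⟩ ⟨h1, h2⟩
    obtain rfl : z' = z := h1
    obtain rfl : o' = o := h2
    rfl
  rw [cl_eq_prod hE hO H]
  simp [hF, ZMod.card]

/-- The tuples whose image under a map lies in a given set of tuples. -/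
def powPreimage {Z Y : SmoothSet E} (g : Z →[G] Y) (T : SubMulAction G (ZMod p → Y)) :
    SubMulAction G (ZMod p → Z) where
  carrier := {t | (fun i => g (t i)) ∈ T}
  smul_mem' c t ht := by
    have : (fun i => g ((c • t) i)) = c • fun i => g (t i) := by
      funext i
      exact map_smul g c _
    simp only [Set.mem_ofPred_eq]
    rw [this]
    exact T.smul_mem c ht

/-- Over an orbit O of T, lifting a tuple means lifting its p entries independently, so
`cl_eq_pow_of_cartesian` applies with the entries as the maps O → Y. -/
theorem cl_powPreimage {Z Y X : SmoothSet E} (hY : Y.IsTransitive) (hX : X.IsTransitive)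
    (g : Z →[G] Y) (f : Y →[G] X) (T : SubMulAction G (ZMod p → Y)) :
    cl (powSubMap hE (f.comp g) (powPreimage g T)) hX =
      cl (powSubMap hE f T) hX * cl g hY ^ p := by
  let b : powSub hE (powPreimage g T) →[G] powSub hE T :=
    { toFun := fun t : powPreimage g T => (⟨fun i => g (t.1 i), t.2⟩ : T)
      map_smul' := fun c (t : powPreimage g T) =>
        Subtype.ext (funext fun i => map_smul g c (t.1 i)) }
  let π : powSub hE (powPreimage g T) → MulAction.orbitRel.Quotient G (powSub hE T) :=
    fun t => Quotient.mk _ (b t)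
  have hπ : ∀ (c : G) t, π (c • t) = π t := fun c t =>
    Quotient.sound ⟨c, (map_smul b c t).symm⟩
  rw [cl_eq_sum_orbits (powSubMap hE f T), cl_eq_sum_fiber _ hX π hπ, Finset.sum_mul]
  refine Finset.sum_congr rfl fun o _ => ?_
  let O := (powSub hE T).sub (orbitSub (powSub hE T) o)
  have hO : O.IsTransitive := orbitSub_isTransitive _ o
  let V := (powSub hE (powPreimage g T)).sub (fiberSub _ π hπ o)
  let v : V →[G] O :=
    { toFun := fun q => ⟨b q.1, q.2⟩
      map_smul' := fun c q => Subtype.ext (map_smul b c q.1) }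
  let e : ZMod p → (O →[G] Y) := fun i =>
    { toFun := fun q => (q.1 : T).1 i
      map_smul' := fun _ _ => rfl }
  let d : ZMod p → (V →[G] Z) := fun i =>
    { toFun := fun q => (q.1 : powPreimage g T).1 i
      map_smul' := fun _ _ => rfl }
  rw [← cl_eq_pow_of_cartesian hE hO hY g e v d (fun i q => rfl), ← cl_comp hO hX]
  · rfl
  · rintro ⟨q, hq⟩ t ht
    obtain ⟨s, hs⟩ : T := q
    have h1 : (fun i => g (t i)) = s := funext ht
    have h2 : t ∈ powPreimage g T := by
      change (fun i => g (t i)) ∈ T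
      rwa [h1]
    subst h1
    refine ⟨⟨(⟨t, h2⟩ : powPreimage g T), hq⟩, ⟨rfl, fun i => rfl⟩, ?_⟩
    rintro ⟨r, hr⟩ ⟨-, h4⟩
    exact Subtype.ext (Subtype.ext (funext h4))

/-- A nonconstant tuple in a fibre of f ∘ g has either a nonconstant image in Y, which rotates
uniquely into T, or a constant image, and then it lies in a fibre of g and rotates into T'. The two
cases give the two summands. -/
theorem cl_transversal_comp {Z Y X : SmoothSet E} (hY : Y.IsTransitive) (hX : X.IsTransitive)
    (g : Z →[G] Y) (f : Y →[G] X) {S : SubMulAction G (ZMod p → Z)}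
    (hS : IsTransversal (nonconst (f.comp g) p) S) {T : SubMulAction G (ZMod p → Y)}
    (hT : IsTransversal (nonconst f p) T) {T' : SubMulAction G (ZMod p → Z)}
    (hT' : IsTransversal (nonconst g p) T') :
    cl (powSubMap hE (f.comp g) S) hX =
      cl (powSubMap hE f T) hX * cl g hY ^ p + cl f hX * cl (powSubMap hE g T') hY := by
  let U : SubMulAction G (ZMod p → Z) :=
    { carrier := {t | t ∈ powPreimage g T ∨ t ∈ T'}
      smul_mem' := fun c t ht => ht.imp (SubMulAction.smul_mem _ c) (SubMulAction.smul_mem _ c) }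
  have hU : IsTransversal (nonconst (f.comp g) p) U := by
    refine ⟨rot_mem_nonconst _, ?_, fun t ht => ?_⟩
    · rintro t (ht | ht)
      · obtain ⟨h1, i, hi⟩ := hT.mem _ ht
        exact ⟨h1, i, fun h => hi (congrArg g h)⟩
      · obtain ⟨h1, h2⟩ := hT'.mem _ ht
        exact ⟨fun i => congrArg f (h1 i), h2⟩
    · by_cases hc : ∃ i, g (t i) ≠ g (t 0)
      · have h1 : (fun i => g (t i)) ∈ nonconst f p := ⟨ht.1, hc⟩
        obtain ⟨j, hj, hj'⟩ := hT.existsUnique _ h1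
        refine ⟨j, .inl hj, ?_⟩
        rintro k (hk | hk)
        · exact hj' k hk
        · have h2 := (hT'.mem _ hk).1
          obtain ⟨i, hi⟩ := hc
          have h4 := h2 (i - k)
          have h5 := h2 (0 - k)
          simp only [rot_apply, sub_add_cancel] at h4 h5
          exact absurd (h4.trans h5.symm) hi
      · push Not at hc
        obtain ⟨j, hj, hj'⟩ := hT'.existsUnique t ⟨hc, ht.2⟩
        refine ⟨j, .inr hj, ?_⟩
        rintro k (hk | hk)
        · obtain ⟨i, hi⟩ := (hT.mem _ hk).2
          exact absurd ((hc _).trans (hc _).symm) hi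
        · exact hj' k hk
  have h1 : cl f hX * cl (powSubMap hE g T') hY = cl (powSubMap hE (f.comp g) T') hX := by
    rw [← cl_comp hY hX]
    rfl
  rw [cl_eq_of_isTransversal hE _ hX (N := nonconst (f.comp g) p) (fun t ht => ht.1) hS hU, h1, ← cl_powPreimage]
  let i₁ : powSub hE (powPreimage g T) →[G] powSub hE U :=
    { toFun := fun t : powPreimage g T => (⟨t.1, .inl t.2⟩ : U)
      map_smul' := fun _ _ => rfl }
  let i₂ : powSub hE T' →[G] powSub hE U :=
    { toFun := fun t : T' => (⟨t.1, .inr t.2⟩ : U)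
      map_smul' := fun _ _ => rfl }
  have hdisj : ∀ t : ZMod p → Z, t ∈ powPreimage g T → t ∉ T' := by
    intro t h2 h3
    obtain ⟨i, hi⟩ := (hT.mem _ h2).2
    exact hi ((hT'.mem _ h3).1 i)
  refine cl_add hX _ i₁ i₂ ⟨?_, fun t => ?_⟩
  · rintro (a | a) (c | c) h
    · have h' := congrArg Subtype.val h
      exact congrArg Sum.inl (Subtype.ext h')
    · obtain ⟨a, ha⟩ : powPreimage g T := a
      obtain ⟨c, hc⟩ : T' := c
      obtain rfl : a = c := congrArg Subtype.val h
      exact absurd hc (hdisj a ha)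
    · obtain ⟨a, ha⟩ : T' := a
      obtain ⟨c, hc⟩ : powPreimage g T := c
      obtain rfl : a = c := congrArg Subtype.val h
      exact absurd ha (hdisj a hc)
    · have h' := congrArg Subtype.val h
      exact congrArg Sum.inr (Subtype.ext h')
  · obtain ⟨t, ht | ht⟩ : U := t
    · exact ⟨.inl (⟨t, ht⟩ : powPreimage g T), rfl⟩
    · exact ⟨.inr (⟨t, ht⟩ : T'), rfl⟩

/-- The cyclic tuples in the fibres of `f` with a given pattern of colours. -/
def patternSub {Y X : SmoothSet E} (f : Y →[G] X) (c : Y → Bool)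
    (hc : ∀ (g : G) y, c (g • y) = c y) (w : ZMod p → Bool) : SubMulAction G (ZMod p → Y) where
  carrier := {t | t ∈ fiberPow f p ∧ ∀ k, c (t k) = w k}
  smul_mem' g _ ht := ⟨SubMulAction.smul_mem _ g ht.1, fun k => (hc g _).trans (ht.2 k)⟩

/-- Tuples with colour pattern w are the fibre product over X of the pieces F (w k). -/
theorem cl_patternSub {Y X : SmoothSet E} (hX : X.IsTransitive) (f : Y →[G] X) (c : Y → Bool)
    (hc : ∀ (g : G) y, c (g • y) = c y) (w : ZMod p → Bool) (F : Bool → SmoothSet E)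
    (i : ∀ b, F b →[G] Y) (hinj : ∀ b, Function.Injective (i b))
    (hci : ∀ b y, c y = b ↔ ∃ z, i b z = y) :
    cl (powSubMap hE f (patternSub f c hc w)) hX = ∏ k, cl (f.comp (i (w k))) hX := by
  choose r hr using fun (k : ZMod p) (t : patternSub f c hc w) => (hci (w k) _).1 (t.2.2 k)
  let a : ∀ k, powSub hE (patternSub f c hc w) →[G] F (w k) := fun k =>
    { toFun := fun t : patternSub f c hc w => r k t
      map_smul' := fun g (t : patternSub f c hc w) => hinj _ (by
        change i (w k) (r k (g • t)) = i (w k) (g • r k t)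
        rw [hr, map_smul, hr]
        rfl) }
  have H : IsFiberProd (powSubMap hE f (patternSub f c hc w)) (fun k => f.comp (i (w k))) a := by
    refine ⟨fun k (t : patternSub f c hc w) => ?_, fun x t ht => ?_⟩
    · change f (i (w k) (r k t)) = f (t.1 0)
      rw [hr, t.2.1 k]
    · have h1 : (fun k => i (w k) (t k)) ∈ patternSub f c hc w :=
        ⟨fun k => (ht k).trans (ht 0).symm, fun k => (hci _ _).2 ⟨_, rfl⟩⟩
      refine ⟨(⟨_, h1⟩ : patternSub f c hc w), ⟨ht 0, fun k => hinj _ (hr k ⟨_, h1⟩)⟩, ?_⟩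
      rintro (q : patternSub f c hc w) ⟨-, h3⟩
      refine Subtype.ext (funext fun k => ?_)
      change q.1 k = i (w k) (t k)
      rw [← h3 k]
      exact (hr k q).symm
  rw [cl_eq_prod hE hX H]

/-- Colour each point of Y by the piece containing it. A monochromatic tuple rotates into the
transversal of its piece; any other has a nonconstant colour word, with a unique rotation in W, and
its pattern contributes a product of classes. -/
theorem cl_transversal_add {Y X : SmoothSet E} (hX : X.IsTransitive) (f : Y →[G] X)
    (F : Bool → SmoothSet E) (i : ∀ b, F b →[G] Y)
    (hi : Function.Bijective (fun q : Σ b, F b => i q.1 q.2))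
    {S : SubMulAction G (ZMod p → Y)} (hS : IsTransversal (nonconst f p) S)
    {T : ∀ b, SubMulAction G (ZMod p → F b)}
    (hT : ∀ b, IsTransversal (nonconst (f.comp (i b)) p) (T b)) {W : Finset (ZMod p → Bool)}
    (hW : ∀ w ∈ W, ∃ i, w i ≠ w 0)
    (hW' : ∀ w : ZMod p → Bool, (∃ i, w i ≠ w 0) → ∃! j, rot j w ∈ W) :
    cl (powSubMap hE f S) hX = cl (powSubMap hE (f.comp (i true)) (T true)) hX +
      cl (powSubMap hE (f.comp (i false)) (T false)) hX +
        ∑ w ∈ W, ∏ k, cl (f.comp (i (w k))) hX := by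
  have hinj : ∀ b, Function.Injective (i b) := by
    intro b y z h
    have := @hi.1 ⟨b, y⟩ ⟨b, z⟩ h
    simpa using this
  choose c hc using fun y => (⟨(hi.2 y).choose.1, (hi.2 y).choose.2, (hi.2 y).choose_spec⟩ :
    ∃ b, ∃ z, i b z = y)
  have hci : ∀ b y, c y = b ↔ ∃ z, i b z = y := by
    intro b y
    constructor
    · rintro rfl
      exact hc y
    · rintro ⟨z, hz⟩
      obtain ⟨z', hz'⟩ := hc y
      exact congrArg Sigma.fst (@hi.1 ⟨c y, z'⟩ ⟨b, z⟩ (hz'.trans hz.symm))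
  have hcs : ∀ (g : G) y, c (g • y) = c y := by
    intro g y
    obtain ⟨z, hz⟩ := hc y
    exact (hci _ _).2 ⟨g • z, by rw [map_smul, hz]⟩
  have hcb : ∀ b z, c (i b z) = b := fun b z => (hci _ _).2 ⟨z, rfl⟩
  let U : SubMulAction G (ZMod p → Y) :=
    { carrier := {t | (∃ b, ∃ s ∈ T b, t = fun k => i b (s k)) ∨
        (t ∈ fiberPow f p ∧ (fun k => c (t k)) ∈ W)}
      smul_mem' := by
        rintro g t (⟨b, s, hs, rfl⟩ | ⟨h1, h2⟩)
        · exact .inl ⟨b, g • s, (T b).smul_mem g hs, funext fun k => (map_smul (i b) g _).symm⟩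
        · refine .inr ⟨SubMulAction.smul_mem _ g h1, ?_⟩
          convert h2 using 1
          funext k
          exact hcs g _ }
  have hU : IsTransversal (nonconst f p) U := by
    refine ⟨rot_mem_nonconst _, ?_, fun t ht => ?_⟩
    · rintro t (⟨b, s, hs, rfl⟩ | ⟨h1, h2⟩)
      · obtain ⟨h1, k, hk⟩ := (hT b).mem s hs
        exact ⟨h1, k, fun h => hk (hinj b h)⟩
      · obtain ⟨k, hk⟩ := hW _ h2
        exact ⟨h1, k, fun h => hk (by rw [h])⟩
    · by_cases hcol : ∃ k, c (t k) ≠ c (t 0)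
      · obtain ⟨j, hj, hj'⟩ := hW' _ hcol
        refine ⟨j, .inr ⟨(rot_mem_nonconst f t ht j).1, hj⟩, ?_⟩
        rintro k (⟨b, s, hs, h1⟩ | ⟨-, h2⟩)
        · obtain ⟨l, hl⟩ := hcol
          have h2 : ∀ l, c (t (l + k)) = b := fun l => by
            rw [← hcb b (s l)]
            exact congrArg c (congrFun h1 l)
          have h4 := h2 (l - k)
          have h5 := h2 (0 - k)
          rw [sub_add_cancel] at h4 h5
          exact absurd (h4.trans h5.symm) hl
        · exact hj' k h2
      · push Not at hcol
        obtain ⟨b, hb⟩ : ∃ b, ∀ k, c (t k) = b := ⟨_, hcol⟩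
        choose s hs using fun k => (hci b (t k)).1 (hb k)
        obtain rfl : (fun k => i b (s k)) = t := funext hs
        have h1 : s ∈ nonconst (f.comp (i b)) p := by
          obtain ⟨h1, k, hk⟩ := ht
          exact ⟨h1, k, fun h => hk (congrArg (i b) h)⟩
        obtain ⟨j, hj, hj'⟩ := (hT b).existsUnique s h1
        refine ⟨j, .inl ⟨b, _, hj, rfl⟩, ?_⟩
        rintro k (⟨b', s', hs', h2⟩ | ⟨-, h2⟩)
        · obtain rfl : b = b' := by
            rw [← hcb b (s (0 + k)), ← hcb b' (s' 0)]
            exact congrArg c (congrFun h2 0)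
          obtain rfl : rot k s = s' := funext fun l => hinj b (congrFun h2 l)
          exact hj' k hs'
        · obtain ⟨l, hl⟩ := hW _ h2
          exact absurd ((hb _).trans (hb _).symm) hl
  rw [cl_eq_of_isTransversal hE _ hX (N := nonconst f p) (fun t ht => ht.1) hS hU]
  let A : Bool ⊕ W → SmoothSet E :=
    Sum.elim (fun b => powSub hE (T b)) (fun w => powSub hE (patternSub f c hcs w.1))
  let a : ∀ o, A o →[G] powSub hE U
    | .inl b =>
      { toFun := fun s : T b => (⟨fun k => i b (s.1 k), .inl ⟨b, s.1, s.2, rfl⟩⟩ : U)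
        map_smul' := fun g (s : T b) => Subtype.ext (funext fun k => map_smul (i b) g _) }
    | .inr w =>
      { toFun := fun t : patternSub f c hcs w.1 => (⟨t.1, .inr ⟨t.2.1, by
          convert w.2 using 1
          exact funext t.2.2⟩⟩ : U)
        map_smul' := fun _ _ => rfl }
  rw [cl_eq_sum _ hX A a, Fintype.sum_sum_type, Fintype.sum_bool]
  · congr 1
    rw [← Finset.sum_coe_sort W]
    refine Finset.sum_congr rfl fun w _ => ?_
    rw [← cl_patternSub hE hX f c hcs w.1 F i hinj hci]
    rfl
  · constructor
    · rintro ⟨b | w, t⟩ ⟨b' | w', t'⟩ h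
      · obtain ⟨t, ht⟩ : T b := t
        obtain ⟨t', ht'⟩ : T b' := t'
        have h2 : (fun k => i b (t k)) = fun k => i b' (t' k) := congrArg Subtype.val h
        obtain rfl : b = b' := by
          rw [← hcb b (t 0), ← hcb b' (t' 0)]
          exact congrArg c (congrFun h2 0)
        obtain rfl : t = t' := funext fun k => hinj b (congrFun h2 k)
        rfl
      · obtain ⟨t, ht⟩ : T b := t
        obtain ⟨t', ht'⟩ : patternSub f c hcs w'.1 := t'
        have h2 : (fun k => i b (t k)) = t' := congrArg Subtype.val h
        obtain ⟨k, hk⟩ := hW _ w'.2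
        rw [← ht'.2, ← ht'.2, ← h2, hcb, hcb] at hk
        exact absurd rfl hk
      · obtain ⟨t, ht⟩ : patternSub f c hcs w.1 := t
        obtain ⟨t', ht'⟩ : T b' := t'
        have h2 : t = (fun k => i b' (t' k)) := congrArg Subtype.val h
        obtain ⟨k, hk⟩ := hW _ w.2
        rw [← ht.2, ← ht.2, h2, hcb, hcb] at hk
        exact absurd rfl hk
      · obtain ⟨t, ht⟩ : patternSub f c hcs w.1 := t
        obtain ⟨t', ht'⟩ : patternSub f c hcs w'.1 := t'
        obtain rfl : t = t' := congrArg Subtype.val h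
        obtain rfl : w = w' := Subtype.ext (funext fun k => (ht.2 k).symm.trans (ht'.2 k))
        rfl
    · intro t
      obtain ⟨t, ⟨b, s, hs, h⟩ | ⟨h1, h2⟩⟩ : U := t
      · exact ⟨⟨.inl b, (⟨s, hs⟩ : T b)⟩, Subtype.ext h.symm⟩
      · have h3 : t ∈ patternSub f c hcs (fun k => c (t k)) := ⟨h1, fun k => rfl⟩
        exact ⟨⟨.inr ⟨_, h2⟩, (⟨t, h3⟩ : patternSub f c hcs _)⟩, rfl⟩

end TransversalRelations

/-! ### Frobenius lifts and torsion -/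

section FrobeniusLift

/-- If an ideal is stable under the `p`-derivation of a Frobenius lift which induces the identity
modulo the ideal, then the quotient has no `p`-torsion. -/
theorem mem_of_prime_mul_mem {P : Type*} [CommRing P] {p : ℕ} (hp : p.Prime)
    (hreg : ∀ x : P, (p : P) * x = 0 → x = 0) (φ : P →+* P)
    (hF : ∀ a, ∃ b, φ a = a ^ p + p * b) (S : Set P)
    (hid : ∀ a, φ a - a ∈ Ideal.span S)
    (hS : ∀ r ∈ S, ∃ c ∈ Ideal.span S, φ r - r ^ p = p * c) {x : P}
    (hx : (p : P) * x ∈ Ideal.span S) : x ∈ Ideal.span S := by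
  -- With δ(y) = (φ(y) - y^p)/p, the formulas for δ of a sum and of a product extend the stability
  -- under δ from the generators to the whole ideal.
  have key : ∀ y ∈ Ideal.span S, ∃ c ∈ Ideal.span S, φ y - y ^ p = p * c := by
    intro y hy
    induction hy using Submodule.span_induction with
    | mem y hy => exact hS y hy
    | zero => exact ⟨0, zero_mem _, by simp [hp.ne_zero]⟩
    | add y z hy hz ihy ihz =>
      obtain ⟨c, hc, h1⟩ := ihy
      obtain ⟨d, hd, h2⟩ := ihz
      obtain ⟨r, hr⟩ := exists_add_pow_prime_eq hp y z
      refine ⟨c + d - y * (z * r), sub_mem (add_mem hc hd) (Ideal.mul_mem_right _ _ hy), ?_⟩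
      rw [hr, map_add]
      linear_combination h1 + h2
    | smul a y hy ih =>
      obtain ⟨c, hc, h1⟩ := ih
      obtain ⟨b, hb⟩ := hF a
      refine ⟨φ a * c + b * y ^ p, add_mem (Ideal.mul_mem_left _ _ hc)
        (Ideal.mul_mem_left _ _ (Ideal.pow_mem_of_mem _ hy p hp.pos)), ?_⟩
      rw [smul_eq_mul, map_mul, mul_pow]
      linear_combination φ a * h1 + y ^ p * hb
  obtain ⟨c, hc, h⟩ := key _ hx
  -- After cancelling p, δ(px) = φ(x) - p^(p-1) x^p. Since p ≥ 2, the last term is px times p^q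
  -- x^(q+1) and lies in the ideal.
  obtain ⟨q, rfl⟩ : ∃ q, p = q + 2 := ⟨p - 2, by have := hp.two_le; omega⟩
  rw [map_mul, map_natCast] at h
  have h1 : φ x - ((q + 2 : ℕ) : P) ^ (q + 1) * x ^ (q + 2) - c = 0 := by
    apply hreg
    linear_combination h
  have h2 : φ x ∈ Ideal.span S := by
    have : φ x = c + (((q + 2 : ℕ) : P) * x) * (((q + 2 : ℕ) : P) ^ q * x ^ (q + 1)) := by
      linear_combination h1
    rw [this]
    exact add_mem hc (Ideal.mul_mem_right _ _ hx)
  simpa using sub_mem h2 (hid x)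

end FrobeniusLift

/-! ### Absence of p-torsion in Θ -/

section Torsion

variable {G : Type u} [Group G] {E : Set (Subgroup G)} (hE : ProdClosed E) {p : ℕ} [Fact p.Prime]
  (hr : RotFree E p)

/-- The symbol of a transversal of the nonconstant cyclic `p`-tuples of a symbol. -/
noncomputable def transSymb (s : Symb E) : Symb E :=
  ⟨powSub hE (hr.exists_isTransversal s.map).choose, s.X, powSubMap hE s.map _, s.trans⟩

/-- A Frobenius lift on the polynomial ring in the symbols, inducing the identity on `Θ`. -/
noncomputable def frobLift : MvPolynomial (Symb E) ℤ →+* MvPolynomial (Symb E) ℤ :=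
  MvPolynomial.eval₂Hom MvPolynomial.C fun s =>
    MvPolynomial.X s ^ p - (p : MvPolynomial (Symb E) ℤ) * MvPolynomial.X (transSymb hE hr s)

theorem frobLift_X (s : Symb E) : frobLift hE hr (MvPolynomial.X s) =
    MvPolynomial.X s ^ p - (p : MvPolynomial (Symb E) ℤ) * MvPolynomial.X (transSymb hE hr s) := by
  simp [frobLift]

theorem mk_X_transSymb {Y X : SmoothSet E} (f : Y →[G] X) (hX : X.IsTransitive)
    {T : SubMulAction G (ZMod p → Y)} (hT : IsTransversal (nonconst f p) T) :
    Ideal.Quotient.mk (relIdeal E) (MvPolynomial.X (transSymb hE hr ⟨Y, X, f, hX⟩)) =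
      cl (powSubMap hE f T) hX :=
  cl_eq_of_isTransversal hE f hX (N := nonconst f p) (fun _ ht => ht.1)
    (hr.exists_isTransversal f).choose_spec hT

theorem mk_X {Y X : SmoothSet E} (f : Y →[G] X) (hX : X.IsTransitive) :
    Ideal.Quotient.mk (relIdeal E) (MvPolynomial.X ⟨Y, X, f, hX⟩) = cl f hX := rfl

/-- On constants the lift is the identity, and the congruence is Fermat's little theorem. -/
theorem exists_frobLift_eq (a : MvPolynomial (Symb E) ℤ) :
    ∃ b, frobLift hE hr a = a ^ p + p * b := by
  have hp : p.Prime := Fact.out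
  induction a using MvPolynomial.induction_on with
  | C n =>
    obtain ⟨k, hk⟩ : (p : ℤ) ∣ n - n ^ p := by
      rw [← ZMod.intCast_zmod_eq_zero_iff_dvd]
      simp
    refine ⟨MvPolynomial.C k, ?_⟩
    have h1 : frobLift hE hr (MvPolynomial.C n) = MvPolynomial.C n := by simp [frobLift]
    have h2 : n = n ^ p + p * k := by linear_combination hk
    rw [h1]
    conv_lhs => rw [h2]
    simp
  | add a b ha hb =>
    obtain ⟨c, hc⟩ := ha
    obtain ⟨d, hd⟩ := hb
    obtain ⟨r, hr'⟩ := exists_add_pow_prime_eq hp a b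
    refine ⟨c + d - a * b * r, ?_⟩
    rw [map_add, hc, hd, hr']
    ring
  | mul_X a s ha =>
    obtain ⟨c, hc⟩ := ha
    refine ⟨c * MvPolynomial.X s ^ p -
      (a ^ p + (p : MvPolynomial (Symb E) ℤ) * c) * MvPolynomial.X (transSymb hE hr s), ?_⟩
    rw [map_mul, hc, frobLift_X]
    ring

theorem frobLift_sub_mem (a : MvPolynomial (Symb E) ℤ) : frobLift hE hr a - a ∈ relIdeal E := by
  rw [← Ideal.Quotient.eq]
  have : (Ideal.Quotient.mk (relIdeal E)).comp (frobLift hE hr) =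
      Ideal.Quotient.mk (relIdeal E) := by
    refine MvPolynomial.ringHom_ext (fun n => ?_) fun s => ?_
    · simp [frobLift]
    · obtain ⟨Y, X, f, hX⟩ := s
      obtain ⟨T, hT⟩ := hr.exists_isTransversal f
      rw [RingHom.comp_apply, frobLift_X, map_sub, map_pow, map_mul, map_natCast,
        mk_X_transSymb hE hr f hX hT, mk_X, cl_pow_eq hE f hX hT]
      ring
  exact RingHom.congr_fun this a

/-- In each case r^p is compared with the p-th powers of its terms by expanding (r + rest)^p, which
leaves an error pr(…). The other part of the quotient by p vanishes in Θ by the transversal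
counterpart of the same relation. -/
theorem exists_frobLift_rel {r : MvPolynomial (Symb E) ℤ} (h : Rel E r) :
    ∃ c ∈ relIdeal E, frobLift hE hr r - r ^ p = p * c := by
  have hp : p.Prime := Fact.out
  have hrI : r ∈ relIdeal E := Ideal.subset_span h
  cases h with
  | iso f hf =>
    obtain ⟨Y, X, f, hX⟩ := f
    generalize hx : (MvPolynomial.X ⟨Y, X, f, hX⟩ : MvPolynomial (Symb E) ℤ) = x at *
    obtain ⟨s, hs⟩ := exists_add_pow_prime_eq hp (x - 1) 1
    obtain ⟨T, hT⟩ := hr.exists_isTransversal f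
    refine ⟨(x - 1) * s - MvPolynomial.X (transSymb hE hr ⟨Y, X, f, hX⟩),
      sub_mem (Ideal.mul_mem_right _ _ hrI) ?_, ?_⟩
    · rw [← Ideal.Quotient.eq_zero_iff_mem, mk_X_transSymb hE hr f hX hT]
      exact cl_transversal_of_injective hE f hX hf.1 hT
    · rw [map_sub, map_one, ← hx, frobLift_X, hx]
      rw [sub_add_cancel] at hs
      linear_combination hs
  | @add Y Y₁ Y₂ X hX f i₁ i₂ hi =>
    obtain ⟨W, hW, hW'⟩ := exists_word_transversal p
    let F := boolFamily Y₁ Y₂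
    let i := boolMap i₁ i₂
    have hb := boolMap_bijective hi
    obtain ⟨T, hT⟩ := hr.exists_isTransversal f
    choose T' hT' using fun b => hr.exists_isTransversal (f.comp (i b))
    have hd := cl_transversal_add hE hX f F i hb hT hT' hW hW'
    obtain ⟨q, hq⟩ : ∃ q : Bool → MvPolynomial (Symb E) ℤ,
        ∀ b, q b = MvPolynomial.X ⟨F b, X, f.comp (i b), hX⟩ := ⟨_, fun _ => rfl⟩
    have hw := add_pow_eq_words hW hW' q
    have hq1 : q true = MvPolynomial.X ⟨Y₁, X, f.comp i₁, hX⟩ := hq true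
    have hq2 : q false = MvPolynomial.X ⟨Y₂, X, f.comp i₂, hX⟩ := hq false
    rw [hq1, hq2] at hw
    have e1 := frobLift_X hE hr ⟨Y, X, f, hX⟩
    have e2 := frobLift_X hE hr ⟨Y₁, X, f.comp i₁, hX⟩
    have e3 := frobLift_X hE hr ⟨Y₂, X, f.comp i₂, hX⟩
    have m1 := mk_X_transSymb hE hr f hX hT
    have m2 := mk_X_transSymb hE hr (f.comp i₁) hX (hT' true)
    have m3 := mk_X_transSymb hE hr (f.comp i₂) hX (hT' false)
    have mu : Ideal.Quotient.mk (relIdeal E) (∑ w ∈ W, ∏ k, q (w k)) =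
        ∑ w ∈ W, ∏ k, cl (f.comp (i (w k))) hX := by
      rw [map_sum]
      simp only [map_prod, hq, mk_X]
    rw [← mu] at hd
    generalize ∑ w ∈ W, ∏ k, q (w k) = u at hw hd
    change _ = cl (powSubMap hE (f.comp i₁) (T' true)) hX +
      cl (powSubMap hE (f.comp i₂) (T' false)) hX + _ at hd
    rw [← m1, ← m2, ← m3] at hd
    clear mu m1 m2 m3 hq hq1 hq2
    generalize (MvPolynomial.X ⟨Y, X, f, hX⟩ : MvPolynomial (Symb E) ℤ) = x at *
    generalize (MvPolynomial.X ⟨Y₁, X, f.comp i₁, hX⟩ : MvPolynomial (Symb E) ℤ) = y at *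
    generalize (MvPolynomial.X ⟨Y₂, X, f.comp i₂, hX⟩ : MvPolynomial (Symb E) ℤ) = z at *
    generalize (MvPolynomial.X (transSymb hE hr _) : MvPolynomial (Symb E) ℤ) = a at hd e1
    generalize (MvPolynomial.X (transSymb hE hr _) : MvPolynomial (Symb E) ℤ) = b at hd e2
    generalize (MvPolynomial.X (transSymb hE hr _) : MvPolynomial (Symb E) ℤ) = c at hd e3
    obtain ⟨s, hs⟩ := exists_add_pow_prime_eq hp (x - (y + z)) (y + z)
    rw [sub_add_cancel] at hs
    refine ⟨(x - (y + z)) * ((y + z) * s) + (u - a + b + c),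
      add_mem (Ideal.mul_mem_right _ _ hrI) ?_, ?_⟩
    · rw [← Ideal.Quotient.eq_zero_iff_mem]
      simp only [map_sub, map_add]
      rw [hd]
      ring
    · rw [map_sub, map_add, e1, e2, e3]
      linear_combination hs + hw
  | @comp Z Y X hZ hY hX g f =>
    obtain ⟨S, hS⟩ := hr.exists_isTransversal (f.comp g)
    obtain ⟨T, hT⟩ := hr.exists_isTransversal f
    obtain ⟨T', hT'⟩ := hr.exists_isTransversal g
    have hd := cl_transversal_comp hE hY hX g f hS hT hT'
    have hf := cl_pow_eq hE f hX hT
    have m1 := mk_X_transSymb hE hr (f.comp g) hX hS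
    have m2 := mk_X_transSymb hE hr f hX hT
    have m3 := mk_X_transSymb hE hr g hY hT'
    have n2 := mk_X f hX
    have n3 := mk_X g hY
    have e1 := frobLift_X hE hr ⟨Z, X, f.comp g, hX⟩
    have e2 := frobLift_X hE hr ⟨Y, X, f, hX⟩
    have e3 := frobLift_X hE hr ⟨Z, Y, g, hY⟩
    generalize (MvPolynomial.X ⟨Z, X, f.comp g, hX⟩ : MvPolynomial (Symb E) ℤ) = x at *
    generalize (MvPolynomial.X ⟨Y, X, f, hX⟩ : MvPolynomial (Symb E) ℤ) = y at *
    generalize (MvPolynomial.X ⟨Z, Y, g, hY⟩ : MvPolynomial (Symb E) ℤ) = z at *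
    generalize (MvPolynomial.X (transSymb hE hr _) : MvPolynomial (Symb E) ℤ) = a at m1 e1
    generalize (MvPolynomial.X (transSymb hE hr _) : MvPolynomial (Symb E) ℤ) = b at m2 e2
    generalize (MvPolynomial.X (transSymb hE hr _) : MvPolynomial (Symb E) ℤ) = c at m3 e3
    obtain ⟨s, hs⟩ := exists_add_pow_prime_eq hp (x - y * z) (y * z)
    rw [sub_add_cancel, mul_pow] at hs
    -- The term -pbc comes from the product of the lifts of y and z; in Θ it cancels against the pb
    -- in y^p = y + pb.
    refine ⟨(x - y * z) * (y * z * s) + (y ^ p * c + b * z ^ p - p * b * c - a),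
      add_mem (Ideal.mul_mem_right _ _ hrI) ?_, ?_⟩
    · rw [← Ideal.Quotient.eq_zero_iff_mem]
      simp only [map_sub, map_add, map_mul, map_pow, map_natCast]
      rw [m1, m2, m3, n2, n3, hd, hf]
      ring
    · rw [map_sub, map_mul, e1, e2, e3]
      linear_combination hs
  | @baseChange Y X Y' X' hX hX' f g f' h comm cart =>
    obtain ⟨T, hT⟩ := hr.exists_isTransversal f
    obtain ⟨T', hT'⟩ := hr.exists_isTransversal f'
    have hd := cl_transversal_baseChange hE hX hX' f g f' h comm cart hT hT'
    have m1 := mk_X_transSymb hE hr f hX hT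
    have m2 := mk_X_transSymb hE hr f' hX' hT'
    have e1 := frobLift_X hE hr ⟨Y, X, f, hX⟩
    have e2 := frobLift_X hE hr ⟨Y', X', f', hX'⟩
    generalize (MvPolynomial.X ⟨Y, X, f, hX⟩ : MvPolynomial (Symb E) ℤ) = x at *
    generalize (MvPolynomial.X ⟨Y', X', f', hX'⟩ : MvPolynomial (Symb E) ℤ) = y at *
    generalize (MvPolynomial.X (transSymb hE hr _) : MvPolynomial (Symb E) ℤ) = a at m1 e1
    generalize (MvPolynomial.X (transSymb hE hr _) : MvPolynomial (Symb E) ℤ) = b at m2 e2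
    obtain ⟨s, hs⟩ := exists_add_pow_prime_eq hp (x - y) y
    rw [sub_add_cancel] at hs
    refine ⟨(x - y) * (y * s) + (b - a), add_mem (Ideal.mul_mem_right _ _ hrI) ?_, ?_⟩
    · rw [← Ideal.Quotient.eq_zero_iff_mem, map_sub, m1, m2, hd, sub_self]
    · rw [map_sub, e1, e2]
      linear_combination hs

theorem eq_zero_of_prime_mul_eq_zero (hE : ProdClosed E) (hr : RotFree E p) {x : Theta E} (hx : (p : Theta E) * x = 0) : x = 0 := by
  have hp : p.Prime := Fact.out
  obtain ⟨x, rfl⟩ := Ideal.Quotient.mk_surjective x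
  rw [← map_natCast (Ideal.Quotient.mk (relIdeal E)), ← map_mul,
    Ideal.Quotient.eq_zero_iff_mem] at hx
  rw [Ideal.Quotient.eq_zero_iff_mem]
  refine mem_of_prime_mul_mem hp (fun y hy => ?_) (frobLift hE hr) (exists_frobLift_eq hE hr) _
    (frobLift_sub_mem hE hr) (fun r hrel => exists_frobLift_rel hE hr hrel) hx
  have : (p : MvPolynomial (Symb E) ℤ) ≠ 0 := by
    exact_mod_cast hp.ne_zero
  exact (mul_eq_zero.1 hy).resolve_left this

end Torsion

/-! ### Transitive sets determined by stabilizers -/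

section Transfer

variable {G : Type u} [Group G] {E : Set (Subgroup G)}

theorem SmoothSet.IsTransitive.exists_smul {Y : SmoothSet E} (hY : Y.IsTransitive) (y z : Y) :
    ∃ g : G, g • y = z :=
  hY.2.exists_smul_eq y z

theorem SmoothSet.IsTransitive.exists_hom {Y Z : SmoothSet E} (hY : Y.IsTransitive) {y : Y} {z : Z}
    (h : MulAction.stabilizer G y ≤ MulAction.stabilizer G z) : ∃ φ : Y →[G] Z, φ y = z := by
  choose s hs using hY.exists_smul y
  have key : ∀ g g' : G, g • y = g' • y → g • z = g' • z := by
    intro g g' hg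
    have : g'⁻¹ * g ∈ MulAction.stabilizer G y := by
      rw [MulAction.mem_stabilizer_iff, mul_smul, hg, inv_smul_smul]
    have := h this
    rwa [MulAction.mem_stabilizer_iff, mul_smul, inv_smul_eq_iff] at this
  refine ⟨⟨fun w => s w • z, fun g w => ?_⟩, ?_⟩
  · change s (g • w) • z = g • s w • z
    rw [smul_smul]
    apply key
    rw [hs, mul_smul, hs]
  · change s y • z = z
    have := key (s y) 1 (by rw [hs, one_smul])
    rwa [one_smul] at this

theorem SmoothSet.IsTransitive.hom_ext {Y Z : SmoothSet E} (hY : Y.IsTransitive) {φ ψ : Y →[G] Z}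
    {y : Y} (h : φ y = ψ y) : φ = ψ := by
  ext w
  obtain ⟨g, rfl⟩ := hY.exists_smul y w
  rw [map_smul, map_smul, h]

theorem SmoothSet.IsTransitive.bijective {Y Z : SmoothSet E} (hY : Y.IsTransitive)
    (hZ : Z.IsTransitive) (φ : Y →[G] Z) {y : Y}
    (h : MulAction.stabilizer G (φ y) ≤ MulAction.stabilizer G y) : Function.Bijective φ := by
  constructor
  · intro a b hab
    obtain ⟨g, rfl⟩ := hY.exists_smul y a
    obtain ⟨k, rfl⟩ := hY.exists_smul y b
    rw [map_smul, map_smul] at hab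
    have : k⁻¹ * g ∈ MulAction.stabilizer G (φ y) := by
      rw [MulAction.mem_stabilizer_iff, mul_smul, hab, inv_smul_smul]
    have := h this
    rwa [MulAction.mem_stabilizer_iff, mul_smul, inv_smul_eq_iff] at this
  · intro z
    obtain ⟨g, rfl⟩ := hZ.exists_smul (φ y) z
    exact ⟨g • y, map_smul φ g y⟩

/-- Equal stabilizers give isomorphisms of sources and of targets commuting with the maps, and such
a square is a base change. -/
theorem cl_eq_of_stabilizer_eq {Y X Y' X' : SmoothSet E} (hY : Y.IsTransitive)
    (hX : X.IsTransitive) (hY' : Y'.IsTransitive) (hX' : X'.IsTransitive) (f : Y →[G] X)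
    (f' : Y' →[G] X') (y : Y) (y' : Y')
    (h : MulAction.stabilizer G y = MulAction.stabilizer G y')
    (h' : MulAction.stabilizer G (f y) = MulAction.stabilizer G (f' y')) :
    cl f hX = cl f' hX' := by
  obtain ⟨φ, hφ⟩ := hY'.exists_hom h.ge
  obtain ⟨ψ, hψ⟩ := hX'.exists_hom h'.ge
  have hφb := hY'.bijective hY φ (y := y') (by rw [hφ, h])
  have hψb := hX'.bijective hX ψ (y := f' y') (by rw [hψ, h'])
  have comm : f.comp φ = ψ.comp f' := hY'.hom_ext (y := y') (by
    change f (φ y') = ψ (f' y')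
    rw [hφ, hψ])
  have comm' : ∀ w, f (φ w) = ψ (f' w) := fun w => DFunLike.congr_fun comm w
  refine cl_baseChange hX hX' f ψ f' φ comm' fun w x hw => ?_
  obtain ⟨w, rfl⟩ := hφb.2 w
  refine ⟨w, ⟨rfl, hψb.1 ?_⟩, fun v hv => hφb.1 hv.1⟩
  rw [← comm', hw]

end Transfer

/-! ### Basic classes and their p-th powers -/

section BasicClasses

variable {G : Type u} [Group G] {Ω : Type u} [MulAction G Ω]

variable (G Ω) in
/-- The basic classes. -/
def basicClasses : Set (Theta (stabClass G Ω)) :=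
  {t | ∃ (l : ℕ) (x : Fin (l + 1) → Ω), t = cls (basicMap G x)}

theorem stabilizer_tuple {n : ℕ} (x : Fin n → Ω) :
    MulAction.stabilizer G x = fixingSubgroup G (Set.range x) := by
  ext g
  simp [MulAction.mem_stabilizer_iff, mem_fixingSubgroup_iff, funext_iff]

theorem stabilizer_orbitSet {n : ℕ} {x : Fin n → Ω} (y : orbitSet G x) :
    MulAction.stabilizer G y =
      fixingSubgroup G (Set.range (y : MulAction.orbit G x).1) := by
  rw [← stabilizer_tuple]
  ext g
  exact Subtype.ext_iff

/-- An enumeration of a finite set, as a tuple. -/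
noncomputable def enum (A : Finset Ω) : Fin A.card → Ω := fun i => A.equivFin.symm i

theorem range_enum (A : Finset Ω) : Set.range (enum A) = A := by
  ext a
  constructor
  · rintro ⟨i, rfl⟩
    exact (A.equivFin.symm i).2
  · intro ha
    exact ⟨A.equivFin ⟨a, ha⟩, by simp [enum]⟩

theorem cl_mem_basicClasses {Y X : SmoothSet (stabClass G Ω)} (hY : Y.IsTransitive)
    (hX : X.IsTransitive) (f : Y →[G] X) (y : Y) (A : Finset Ω) (d : Ω)
    (h1 : MulAction.stabilizer G (f y) = fixingSubgroup G (A : Set Ω))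
    (h2 : MulAction.stabilizer G y = fixingSubgroup G (insert d (A : Set Ω))) :
    cl f hX ∈ basicClasses G Ω := by
  let x : Fin (A.card + 1) → Ω := Fin.snoc (enum A) d
  have hx : (fun i : Fin A.card => x i.castSucc) = enum A := by
    funext i
    simp [x]
  have hr : Set.range x = insert d (A : Set Ω) := by
    simp only [x, Fin.range_snoc, range_enum]
  refine ⟨_, x, ?_⟩
  refine cl_eq_of_stabilizer_eq hY hX (orbitSet_isTransitive x) (orbitSet_isTransitive _) f
    (basicMap G x).map y ⟨x, MulAction.mem_orbit_self x⟩ ?_ ?_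
  · rw [h2, ← hr]
    exact (stabilizer_orbitSet (G := G) (x := x) ⟨x, MulAction.mem_orbit_self x⟩).symm
  · rw [h1, ← range_enum, ← hx]
    exact (stabilizer_orbitSet (G := G) (x := fun i : Fin A.card => x i.castSucc)
      ⟨_, MulAction.mem_orbit_self _⟩).symm

/-- Adjoining the points of L one at a time factors f into maps with basic classes. The length of
the list is recorded because the degree matters in `basicClasses_pow_eq`. -/
theorem exists_list_prod_eq (L : List Ω) :
    ∀ {Y X : SmoothSet (stabClass G Ω)} (_ : Y.IsTransitive) (hX : X.IsTransitive) (f : Y →[G] X)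
      (y : Y) (A : Finset Ω), MulAction.stabilizer G (f y) = fixingSubgroup G (A : Set Ω) →
      MulAction.stabilizer G y = fixingSubgroup G ((A : Set Ω) ∪ {a | a ∈ L}) →
      ∃ B : List (Theta (stabClass G Ω)), B.length = L.length ∧ (∀ b ∈ B, b ∈ basicClasses G Ω) ∧
        cl f hX = B.prod := by
  classical
  induction L with
  | nil =>
    intro Y X hY hX f y A h1 h2
    refine ⟨[], rfl, by simp, ?_⟩
    rw [List.prod_nil]
    refine cl_of_bijective _ _ (hY.bijective hX f (y := y) ?_)
    rw [h1, h2]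
    simp
  | cons d L ih =>
    intro Y X hY hX f y A h1 h2
    let M := orbitSet G (enum (insert d A))
    have hM : M.IsTransitive := orbitSet_isTransitive _
    let z : M := ⟨enum (insert d A), MulAction.mem_orbit_self _⟩
    have hz : MulAction.stabilizer G z = fixingSubgroup G ((insert d A : Finset Ω) : Set Ω) := by
      rw [← range_enum]
      exact stabilizer_orbitSet z
    have hset : (A : Set Ω) ∪ {a | a ∈ d :: L} = ((insert d A : Finset Ω) : Set Ω) ∪ {a | a ∈ L} := by
      ext a
      simp only [List.mem_cons, Finset.coe_insert, Set.mem_union, Set.mem_insert_iff,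
        Set.mem_ofPred_eq, Finset.mem_coe]
      tauto
    rw [hset] at h2
    obtain ⟨g, hg⟩ := hY.exists_hom (y := y) (z := z) (by
      rw [h2, hz]
      exact fixingSubgroup_antitone G Ω Set.subset_union_left)
    obtain ⟨e, he⟩ := hM.exists_hom (y := z) (z := f y) (by
      rw [h1, hz]
      exact fixingSubgroup_antitone G Ω (by simp))
    obtain rfl : e.comp g = f := hY.hom_ext (y := y) (by
      change e (g y) = f y
      rw [hg, he])
    obtain ⟨B, hB1, hB2, hB3⟩ := ih hY hM g y (insert d A) (by rw [hg, hz]) h2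
    refine ⟨cl e hX :: B, by simp [hB1], ?_, ?_⟩
    · intro b hb
      rcases List.mem_cons.1 hb with rfl | hb
      · refine cl_mem_basicClasses hM hX e z A d ?_ ?_
        · rw [he, h1]
        · rw [hz, Finset.coe_insert]
      · exact hB2 b hb
    · rw [cl_comp hM hX, hB3, List.prod_cons]

theorem exists_list_prod_eq_of_isTransitive {Y X : SmoothSet (stabClass G Ω)}
    (hY : Y.IsTransitive) (hX : X.IsTransitive) (f : Y →[G] X) :
    ∃ B : List (Theta (stabClass G Ω)), (∀ b ∈ B, b ∈ basicClasses G Ω) ∧ cl f hX = B.prod := by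
  classical
  obtain ⟨y⟩ := hY.1
  obtain ⟨A, hA⟩ := X.smooth (f y)
  obtain ⟨B, hB⟩ := Y.smooth y
  have hle : MulAction.stabilizer G y ≤ MulAction.stabilizer G (f y) := by
    intro g hg
    rw [MulAction.mem_stabilizer_iff] at hg ⊢
    rw [← map_smul, hg]
  obtain ⟨L, -, h⟩ := exists_list_prod_eq B.toList hY hX f y A hA (by
    have : {a | a ∈ B.toList} = (B : Set Ω) := by
      ext
      simp
    rw [this, fixingSubgroup_union, ← hA, ← hB]
    exact (inf_eq_right.2 hle).symm)
  exact ⟨L, h⟩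

theorem list_prod_mem_pow {A : Type*} [CommRing A] (N : Submodule ℤ A) (B : List A)
    (hB : ∀ b ∈ B, b ∈ N) : B.prod ∈ N ^ B.length := by
  induction B with
  | nil => simp [Submodule.one_le.1 le_rfl]
  | cons b B ih =>
    rw [List.prod_cons, List.length_cons, pow_succ']
    exact Submodule.mul_mem_mul (hB b (by simp)) (ih fun c hc => hB c (by simp [hc]))

/-- The map T → X factors through the entry t 0 in Y, so [T → X] = bc with c = [T → Y]. The first l
coordinates are common to all entries of t, so an orbit of T is obtained over Y by adjoining only
the last coordinates of the other p - 1 entries. -/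
theorem basicClasses_pow_eq (hG : IsOligomorphic G Ω) {p : ℕ} [Fact p.Prime]
    (hr : RotFree (stabClass G Ω) p) {b : Theta (stabClass G Ω)} (hb : b ∈ basicClasses G Ω) :
    ∃ c ∈ thetaLeOne G Ω ^ (p - 1), b ^ p = b + p * (b * c) := by
  classical
  have hE := prodClosed_stabClass hG
  obtain ⟨l, x, rfl⟩ := hb
  let f := (basicMap G x).map
  have hX := (basicMap G x).trans
  have hY : (basicMap G x).Y.IsTransitive := orbitSet_isTransitive x
  obtain ⟨T, hT⟩ := hr.exists_isTransversal f
  have h1 := cl_pow_eq hE f hX hT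
  let e : powSub hE T →[G] (basicMap G x).Y :=
    { toFun := fun t : T => t.1 0
      map_smul' := fun _ _ => rfl }
  have h2 : cl (powSubMap hE f T) hX = cl f hX * cl e hY := cl_comp hY hX e f
  refine ⟨cl e hY, ?_, ?_⟩
  · rw [cl_eq_sum_orbits]
    refine Submodule.sum_mem _ fun o _ => ?_
    have hO := orbitSub_isTransitive (powSub hE T) o
    obtain ⟨⟨q, hq⟩⟩ := hO.1
    obtain ⟨t, ht⟩ : T := q
    let s : ZMod p → Fin (l + 1) → Ω := fun i => (t i : MulAction.orbit G x).1
    have hs : ∀ i (k : Fin l), s i k.castSucc = s 0 k.castSucc := fun i k =>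
      congrFun (congrArg Subtype.val ((hT.mem t ht).1 i)) k
    let L : List Ω := (Finset.univ.erase (0 : ZMod p)).toList.map fun i => s i (Fin.last l)
    obtain ⟨B, hB1, hB2, hB3⟩ := exists_list_prod_eq L hO hY (e.comp ((powSub hE T).incl _))
      ⟨⟨t, ht⟩, hq⟩ (Finset.univ.image (s 0)) (by
        rw [Finset.coe_image, Finset.coe_univ, Set.image_univ]
        exact stabilizer_orbitSet (t 0)) (by
        ext g
        have : g ∈ MulAction.stabilizer G
            (⟨⟨t, ht⟩, hq⟩ : (powSub hE T).sub (orbitSub (powSub hE T) o)) ↔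
            ∀ i k, g • s i k = s i k := by
          rw [MulAction.mem_stabilizer_iff]
          constructor
          · intro h i k
            exact congrFun (congrArg Subtype.val (congrFun
              (congrArg Subtype.val (congrArg Subtype.val h)) i)) k
          · intro h
            exact Subtype.ext (Subtype.ext (funext fun i => Subtype.ext (funext fun k => h i k)))
        refine this.trans ?_
        rw [mem_fixingSubgroup_iff]
        constructor
        · rintro h a (ha | ha)
          · obtain ⟨k, -, rfl⟩ := Finset.mem_image.1 (Finset.mem_coe.1 ha)
            exact h 0 k
          · obtain ⟨i, -, rfl⟩ := List.mem_map.1 ha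
            exact h i _
        · intro h i k
          refine Fin.lastCases ?_ (fun k => ?_) k
          · by_cases hi : i = 0
            · subst hi
              exact h _ (.inl (by simp))
            · exact h _ (.inr (List.mem_map.2 ⟨i, by simp [hi], rfl⟩))
          · rw [hs]
            exact h _ (.inl (by simp)))
    rw [hB3]
    have hlen : B.length = p - 1 := by
      rw [hB1]
      simp [L, ZMod.card]
    rw [← hlen]
    exact list_prod_mem_pow _ _ fun b hb => Submodule.subset_span (hB2 b hb)
  · rw [h2] at h1
    exact h1

end BasicClasses

/-! ### Counting orbits -/

section Counting

variable {G : Type u} [Group G] {E : Set (Subgroup G)}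

/-- The number of orbits of a smooth set. -/
noncomputable def orbitCount (Y : SmoothSet E) : ℕ := Nat.card (MulAction.orbitRel.Quotient G Y)

theorem SmoothSet.IsTransitive.orbitCount_eq_one {Y : SmoothSet E} (hY : Y.IsTransitive) :
    orbitCount Y = 1 := by
  rw [orbitCount, Nat.card_eq_one_iff_unique]
  obtain ⟨⟨y⟩, h⟩ := hY
  exact ⟨(MulAction.pretransitive_iff_subsingleton_quotient G _).1 h, ⟨Quotient.mk _ y⟩⟩

theorem orbitCount_eq_sum {J : Type*} [Fintype J] {Y : SmoothSet E} (F : J → SmoothSet E)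
    (i : ∀ j, F j →[G] Y) (hi : Function.Bijective (fun q : Σ j, F j => i q.1 q.2)) :
    orbitCount Y = ∑ j, orbitCount (F j) := by
  have hf : ∀ j, Finite (MulAction.orbitRel.Quotient G (F j)) := fun j => (F j).finitary
  simp only [orbitCount]
  rw [← Nat.card_sigma]
  refine (Nat.card_congr (Equiv.ofBijective (fun q : Σ j, MulAction.orbitRel.Quotient G (F j) =>
    (Quotient.map' (i q.1) (by
      rintro a b ⟨g, rfl⟩
      exact ⟨g, (map_smul _ g b).symm⟩) q.2 : MulAction.orbitRel.Quotient G Y)) ⟨?_, ?_⟩)).symm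
  · rintro ⟨j, ⟨a⟩⟩ ⟨k, ⟨b⟩⟩ h
    obtain ⟨g, hg⟩ := Quotient.exact h
    have h2 := @hi.1 ⟨k, g • b⟩ ⟨j, a⟩ ((map_smul _ g b).trans hg)
    obtain rfl : k = j := congrArg Sigma.fst h2
    obtain rfl : g • b = a := eq_of_heq (Sigma.mk.inj h2).2
    exact congrArg (Sigma.mk k) (Quotient.sound ⟨g, rfl⟩)
  · rintro ⟨y⟩
    obtain ⟨⟨j, z⟩, rfl⟩ := hi.2 y
    exact ⟨⟨j, Quotient.mk _ z⟩, rfl⟩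

theorem orbitCount_congr {Y Z : SmoothSet E} (i : Z →[G] Y) (hi : Function.Bijective i) :
    orbitCount Z = orbitCount Y := by
  rw [orbitCount_eq_sum (fun _ : Unit => Z) (fun _ => i)]
  · simp
  · constructor
    · rintro ⟨_, a⟩ ⟨_, b⟩ h
      obtain rfl := hi.1 h
      rfl
    · intro y
      obtain ⟨a, ha⟩ := hi.2 y
      exact ⟨⟨(), a⟩, ha⟩

end Counting

/-! ### Oddness and homomorphisms to the field with two elements -/

section Parity

variable {G : Type u} [Group G] {Ω : Type u} [MulAction G Ω]

/-- Oddness says that the part of Y' over each orbit of Y has an odd number of orbits. -/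
theorem orbitCount_baseChange (hG : IsOligomorphic G Ω) (hodd : IsOdd G Ω)
    {Y X Y' X' : SmoothSet (stabClass G Ω)} (hX : X.IsTransitive)
    (hX' : X'.IsTransitive) (f : Y →[G] X) (g : X' →[G] X) (f' : Y' →[G] X') (h : Y' →[G] Y)
    (comm : ∀ y', f (h y') = g (f' y'))
    (cart : ∀ (y : Y) (x' : X'), f y = g x' → ∃! y' : Y', h y' = y ∧ f' y' = x') :
    (orbitCount Y : ZMod 2) = orbitCount Y' := by
  have hE := prodClosed_stabClass hG
  let F : MulAction.orbitRel.Quotient G Y → SmoothSet (stabClass G Ω) := fun o =>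
    SmoothSet.fiberProd hE (f.comp (Y.incl (orbitSub Y o))) g
  choose s hs hs' using fun (o : MulAction.orbitRel.Quotient G Y) (q : F o) =>
    cart q.1.1.1 q.1.2 q.2
  let i : ∀ o, F o →[G] Y' := fun o =>
    { toFun := s o
      map_smul' := fun c q => by
        refine (hs' o (c • q) (c • s o q) ⟨?_, ?_⟩).symm
        · rw [map_smul, (hs o q).1]
          rfl
        · rw [map_smul, (hs o q).2]
          rfl }
  have key : orbitCount Y' = ∑ o, orbitCount (F o) := by
    refine orbitCount_eq_sum F i ⟨?_, ?_⟩
    · rintro ⟨o, q⟩ ⟨o', q'⟩ hq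
      change s o q = s o' q' at hq
      have h1 := (hs o q).1
      have h2 := (hs o q).2
      rw [hq, (hs o' q').1] at h1
      rw [hq, (hs o' q').2] at h2
      obtain ⟨⟨⟨y, rfl⟩, x⟩, hy⟩ := q
      obtain ⟨⟨⟨y', rfl⟩, x'⟩, hy'⟩ := q'
      obtain rfl : y' = y := h1
      obtain rfl : x' = x := h2
      rfl
    · intro y'
      refine ⟨⟨Quotient.mk _ (h y'), ⟨(⟨h y', rfl⟩, f' y'), comm y'⟩⟩, ?_⟩
      exact (hs' _ ⟨(⟨h y', rfl⟩, f' y'), comm y'⟩ y' ⟨rfl, rfl⟩).symm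
  have hF : ∀ o, (orbitCount (F o) : ZMod 2) = 1 := fun o =>
    ZMod.natCast_eq_one_iff_odd.2 (hodd _ _ _ (orbitSub_isTransitive Y o) hX' hX _ g)
  rw [key]
  push_cast
  simp only [hF]
  simp [orbitCount]

/-- The homomorphism sends [Y → X] to the number of orbits of Y modulo 2; only relation (d) needs
oddness. -/
theorem exists_hom_of_isOdd (hG : IsOligomorphic G Ω) (hodd : IsOdd G Ω) :
    ∃ μ : Theta (stabClass G Ω) →+* ZMod 2, ∀ t ∈ regularMonoid (stabClass G Ω), μ t = 1 := by
  let ν : MvPolynomial (Symb (stabClass G Ω)) ℤ →+* ZMod 2 :=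
    MvPolynomial.eval₂Hom (Int.castRingHom (ZMod 2)) fun s => orbitCount s.Y
  have hν : ∀ s, ν (MvPolynomial.X s) = orbitCount s.Y := fun s => by simp [ν]
  have hker : relIdeal (stabClass G Ω) ≤ RingHom.ker ν := by
    rw [Ideal.span_le]
    rintro r hr
    change ν r = 0
    cases (show Rel _ r from hr) with
    | iso f hf =>
      rw [map_sub, hν, orbitCount_congr f.map hf, f.trans.orbitCount_eq_one]
      simp
    | @add Y Y₁ Y₂ X hX f i₁ i₂ hi =>
      rw [map_sub, map_add, hν, hν, hν, sub_eq_zero]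
      dsimp only
      rw [orbitCount_eq_sum _ _ (boolMap_bijective hi), Fintype.sum_bool, Nat.cast_add]
      rfl
    | comp hZ hY hX g f =>
      rw [map_sub, map_mul, hν, hν, hν, sub_eq_zero]
      dsimp only
      rw [hZ.orbitCount_eq_one, hY.orbitCount_eq_one]
      simp
    | baseChange hX hX' f g f' h comm cart =>
      rw [map_sub, hν, hν, sub_eq_zero]
      exact orbitCount_baseChange hG hodd hX hX' f g f' h comm cart
  refine ⟨Ideal.Quotient.lift _ ν fun a ha => hker ha, fun t ht => ?_⟩
  induction ht using Submonoid.closure_induction with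
  | mem t ht =>
    obtain ⟨f, hf, rfl⟩ := ht
    change ν (MvPolynomial.X f) = 1
    rw [hν, hf.orbitCount_eq_one, Nat.cast_one]
  | one => exact map_one _
  | mul s t _ _ h1 h2 => rw [map_mul, h1, h2, one_mul]

/-- By base change Y ×_X Z → Z has the class of Y → X, with value 1; on the other hand each orbit of
the fibre product contributes 1. -/
theorem isOdd_of_hom (hG : IsOligomorphic G Ω) (μ : Theta (stabClass G Ω) →+* ZMod 2)
    (hμ : ∀ t ∈ regularMonoid (stabClass G Ω), μ t = 1) : IsOdd G Ω := by
  have hE := prodClosed_stabClass hG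
  intro Y Z X hY hZ hX f g
  have hμ' : ∀ {Y X : SmoothSet (stabClass G Ω)} (_ : Y.IsTransitive) (hX : X.IsTransitive)
      (f : Y →[G] X), μ (cl f hX) = 1 := fun hY hX f =>
    hμ _ (Submonoid.subset_closure ⟨⟨_, _, f, hX⟩, hY, rfl⟩)
  let P := SmoothSet.fiberProd hE f g
  let a : P →[G] Y := ⟨fun q => q.1.1, fun _ _ => rfl⟩
  let b : P →[G] Z := ⟨fun q => q.1.2, fun _ _ => rfl⟩
  have h1 : cl f hX = cl b hZ := by
    refine cl_baseChange hX hZ f g b a (fun q => q.2) fun y z h => ?_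
    refine ⟨⟨(y, z), h⟩, ⟨rfl, rfl⟩, ?_⟩
    rintro ⟨⟨y', z'⟩, hr⟩ ⟨h7, h8⟩
    obtain rfl : y' = y := h7
    obtain rfl : z' = z := h8
    rfl
  have h2 := congrArg μ h1
  rw [hμ' hY, cl_eq_sum_orbits, map_sum,
    Finset.sum_congr rfl fun o _ => hμ' (orbitSub_isTransitive P o) hZ _] at h2
  have h3 : ((Nat.card (MulAction.orbitRel.Quotient G P) : ℕ) : ZMod 2) = 1 := by
    rw [h2]
    simp
  exact ZMod.natCast_eq_one_iff_odd.1 h3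

end Parity

/-! ### Units with Fermat congruences over ℤ[1/m] -/

section AwayIntegers

theorem isPrincipalIdealRing_away (m : ℕ) (B : Type*) [CommRing B] [Algebra ℤ B]
    [IsLocalization.Away (m : ℤ) B] : IsPrincipalIdealRing B := by
  refine ⟨fun J => ?_⟩
  obtain ⟨z, hz⟩ := IsPrincipalIdealRing.principal (J.under ℤ)
  refine ⟨algebraMap ℤ B z, ?_⟩
  rw [← IsLocalization.map_under (Submonoid.powers (m : ℤ)) B J, hz]
  exact (Ideal.map_span _ _).trans (by rw [Set.image_singleton])

theorem exists_algebraMap_eq_of_mem_pow {B R : Type*} [CommRing B] [CommRing R] [Algebra B R]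
    {M : Submodule B R} {r j : B}
    (h : ∀ x ∈ M, ∃ a, algebraMap B R (j * a) = r • x) {n : ℕ} {x : R} (hx : x ∈ M ^ n) :
    ∃ a, algebraMap B R (j ^ n * a) = r ^ n • x := by
  induction hx using Submodule.pow_induction_on_left' with
  | algebraMap b => exact ⟨b, by simp⟩
  | add x y i hx hy h1 h2 =>
    obtain ⟨a, ha⟩ := h1
    obtain ⟨b, hb⟩ := h2
    exact ⟨a + b, by rw [mul_add, map_add, ha, hb, smul_add]⟩
  | mem_mul y hy i x hx h1 =>
    obtain ⟨a, ha⟩ := h1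
    obtain ⟨b, hb⟩ := h y hy
    refine ⟨b * a, ?_⟩
    rw [Algebra.smul_def] at *
    calc algebraMap B R (j ^ (i + 1) * (b * a))
        = algebraMap B R (j * b) * algebraMap B R (j ^ i * a) := by
          rw [← map_mul]
          ring_nf
      _ = _ := by
          rw [ha, hb, map_pow, map_pow, pow_succ]
          ring

variable {m : ℕ} {B : Type*} [CommRing B] [Algebra ℤ B] [IsLocalization.Away (m : ℤ) B]

theorem isUnit_natCast_away : IsUnit (m : B) := by
  have := IsLocalization.Away.algebraMap_isUnit (S := B) (m : ℤ)
  simpa using this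

theorem not_dvd_of_mem {𝔮 : Ideal B} (h𝔮 : 𝔮 ≠ ⊤) {p : ℕ} (hp : (p : B) ∈ 𝔮) (hpm : p ∣ m) :
    False := by
  obtain ⟨k, rfl⟩ := hpm
  refine h𝔮 (Ideal.eq_top_of_isUnit_mem _ ?_ (isUnit_natCast_away (m := p * k)))
  rw [Nat.cast_mul]
  exact Ideal.mul_mem_right _ _ hp

theorem exists_hom_zmod_two (hm : Odd m) : Nonempty (B →+* ZMod 2) := by
  refine ⟨IsLocalization.Away.lift (m : ℤ) (g := Int.castRingHom (ZMod 2)) ?_⟩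
  simp [ZMod.natCast_eq_one_iff_odd.2 hm]

/-- Every maximal ideal of `ℤ[1/m]` contains a prime number that does not divide `m`. -/
theorem exists_prime_mem (hm : Odd m) {𝔮 : Ideal B} (h𝔮 : 𝔮.IsMaximal) :
    ∃ p : ℕ, p.Prime ∧ ¬ p ∣ m ∧ (p : B) ∈ 𝔮 := by
  have hprime := h𝔮.isPrime
  let K := B ⧸ 𝔮
  obtain ⟨p, hp⟩ := CharP.exists K
  have hmem : (p : B) ∈ 𝔮 := by
    rw [← Ideal.Quotient.eq_zero_iff_mem, map_natCast]
    exact CharP.cast_eq_zero K p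
  rcases CharP.char_is_prime_or_zero K p with h | rfl
  · exact ⟨p, h, fun hpm => not_dvd_of_mem h𝔮.ne_top hmem hpm, hmem⟩
  -- In characteristic zero 𝔮 would be zero and ℤ[1/m] a field, so 2 would be invertible, against
  -- the homomorphism to `ZMod 2`.
  · exfalso
    have : CharZero K := CharP.charP_to_charZero K
    have hbot : 𝔮 = ⊥ := by
      rw [eq_bot_iff]
      intro b hb
      obtain ⟨⟨z, s⟩, hz⟩ := IsLocalization.surj (Submonoid.powers (m : ℤ)) b
      have h1 : algebraMap ℤ B z ∈ 𝔮 := by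
        rw [← hz]
        exact Ideal.mul_mem_right _ _ hb
      rw [← Ideal.Quotient.eq_zero_iff_mem, eq_intCast, map_intCast, Int.cast_eq_zero] at h1
      rw [h1, map_zero] at hz
      exact (IsLocalization.map_units B s).mul_left_eq_zero.1 hz
    subst hbot
    obtain ⟨φ⟩ := exists_hom_zmod_two (B := B) hm
    have h2 : IsUnit (2 : B) := by
      by_contra h2
      obtain ⟨𝔭, h𝔭, h3⟩ := exists_max_ideal_of_mem_nonunits h2
      have h4 : 𝔭 = ⊥ := (h𝔮.eq_of_le h𝔭.ne_top bot_le).symm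
      rw [h4, Ideal.mem_bot] at h3
      have h5 := congrArg (Ideal.Quotient.mk (⊥ : Ideal B)) h3
      rw [map_ofNat, map_zero] at h5
      exact two_ne_zero h5
    have h3 := h2.map φ
    rw [map_ofNat] at h3
    exact absurd h3 (by decide)

variable {R : Type*} [CommRing R] [Algebra B R]

/-- A set of units in a torsion-free algebra over `ℤ[1/m]` that spans a finite module and satisfies
Fermat congruences consists of units of `ℤ[1/m]`. -/
theorem exists_isUnit_algebraMap_eq [IsDomain B] (hm : Odd m) [Nontrivial R]
    (htf : ∀ (b : B) (x : R), b • x = 0 → b = 0 ∨ x = 0) {S : Set R} (hS : ∀ x ∈ S, IsUnit x)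
    (hfg : (Submodule.span B (insert 1 S)).FG)
    (hpow : ∀ p : ℕ, p.Prime → ¬ p ∣ m → ∀ x ∈ S,
      ∃ c ∈ Submodule.span B (insert 1 S) ^ (p - 1), x ^ p = x + p * (x * c)) {x : R} (hx : x ∈ S) :
    ∃ b : B, IsUnit b ∧ algebraMap B R b = x := by
  have hPID : IsPrincipalIdealRing B := isPrincipalIdealRing_away m B
  have hinj : ∀ a b : B, algebraMap B R a = algebraMap B R b → a = b := by
    intro a b h
    have h1 : (a - b) • (1 : R) = 0 := by
      rw [← Algebra.algebraMap_eq_smul_one, map_sub, h, sub_self]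
    rcases htf _ _ h1 with h2 | h2
    · exact sub_eq_zero.1 h2
    · exact absurd h2 one_ne_zero
  set M := Submodule.span B (insert 1 S) with hM
  have hfermat : ∀ p : ℕ, p.Prime → ¬ p ∣ m → ∀ x ∈ S, ∃ c ∈ M ^ (p - 1),
      x ^ (p - 1) = 1 + p * c := by
    intro p hp hpm x hx
    obtain ⟨c, hc, h⟩ := hpow p hp hpm x hx
    refine ⟨c, hc, (hS x hx).mul_left_cancel ?_⟩
    rw [← pow_succ', Nat.sub_add_cancel hp.one_le, h]
    ring
  have h2m : ¬ 2 ∣ m := by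
    rw [← even_iff_two_dvd, Nat.not_even_iff_odd]
    exact hm
  -- The congruence at 2 puts S in 1 + 2M, so M ⊆ B·1 + 2M. Nakayama yields r ≡ 1 mod 2 with rM ⊆
  -- B·1, and r ≠ 0 because B maps to `ZMod 2`.
  obtain ⟨r, hr, hrM⟩ := Submodule.exists_sub_one_mem_and_smul_le_of_fg_of_le_sup
    (I := Ideal.span {(2 : B)}) (N := Submodule.span B {(1 : R)}) hfg le_rfl (by
      rw [Submodule.span_le]
      rintro y (rfl | hy)
      · exact Submodule.mem_sup_left (Submodule.mem_span_singleton_self _)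
      · obtain ⟨c, hc, h⟩ := hfermat 2 Nat.prime_two h2m y hy
        rw [Nat.add_one_sub_one, pow_one] at hc h
        rw [SetLike.mem_coe, h]
        refine add_mem (Submodule.mem_sup_left (Submodule.mem_span_singleton_self _))
          (Submodule.mem_sup_right ?_)
        have e : ((2 : ℕ) : R) * c = (2 : B) • c := by
          rw [Algebra.smul_def, map_ofNat, Nat.cast_ofNat]
        rw [e]
        exact Submodule.smul_mem_smul (Ideal.mem_span_singleton_self (2 : B)) hc)
  have hr0 : r ≠ 0 := by
    rintro rfl
    obtain ⟨φ⟩ := exists_hom_zmod_two (B := B) hm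
    obtain ⟨c, hc⟩ := Ideal.mem_span_singleton.1 hr
    have := congrArg φ hc
    rw [map_sub, map_zero, map_one, map_mul, map_ofNat] at this
    have h2 : (2 : ZMod 2) = 0 := rfl
    rw [h2, zero_mul] at this
    exact absurd this (by decide)
  have hrM' : ∀ y ∈ M, ∃ b, algebraMap B R b = r • y := by
    intro y hy
    obtain ⟨b, hb⟩ := Submodule.mem_span_singleton.1 (hrM (Submodule.smul_mem_pointwise_smul y r M hy))
    exact ⟨b, by rw [Algebra.algebraMap_eq_smul_one, hb]⟩
  -- Viewed as an ideal of B, rM is generated by j. Below, r = jk and ry = jn for y in S, so that y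
  -- plays the role of n/k.
  obtain ⟨j, hj⟩ := hPID.principal
    ((M.map (LinearMap.lsmul B R r)).comap (Algebra.linearMap B R))
  have hJ : ∀ b : B, (∃ y ∈ M, r • y = algebraMap B R b) ↔ ∃ a, b = j * a := by
    intro b
    have : b ∈ (M.map (LinearMap.lsmul B R r)).comap (Algebra.linearMap B R) ↔
        b ∈ Ideal.span {j} := by rw [hj]
    rw [Ideal.mem_span_singleton] at this
    have h2 : (∃ y ∈ M, r • y = algebraMap B R b) ↔ j ∣ b := by
      simpa [Submodule.mem_comap, Submodule.mem_map] using this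
    exact h2
  have hdiv : ∀ y ∈ M, ∃ a, algebraMap B R (j * a) = r • y := by
    intro y hy
    obtain ⟨b, hb⟩ := hrM' y hy
    obtain ⟨a, rfl⟩ := (hJ b).1 ⟨y, hy, hb.symm⟩
    exact ⟨a, hb⟩
  have h1M : (1 : R) ∈ M := Submodule.subset_span (Set.mem_insert _ _)
  have hSM : ∀ y ∈ S, y ∈ M := fun y hy => Submodule.subset_span (Set.mem_insert_of_mem _ hy)
  obtain ⟨k, hk⟩ := hdiv 1 h1M
  have hrk : r = j * k := by
    apply hinj
    rw [hk, Algebra.algebraMap_eq_smul_one]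
  have hj0 : j ≠ 0 := by
    rintro rfl
    exact hr0 (by rw [hrk, zero_mul])
  -- Multiply y^(p-1) = 1 + pc by r^(p-1). Since c lies in M^(p-1), r^(p-1) c is divisible by
  -- j^(p-1), the same power that occurs in the other terms, and it cancels.
  have hcong : ∀ p : ℕ, p.Prime → ¬ p ∣ m → ∀ y ∈ S, ∀ n, algebraMap B R (j * n) = r • y →
      ∃ a, n ^ (p - 1) = k ^ (p - 1) + p * a := by
    intro p hp hpm y hy n hn
    obtain ⟨c, hc, h⟩ := hfermat p hp hpm y hy
    obtain ⟨a, ha⟩ := exists_algebraMap_eq_of_mem_pow hdiv hc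
    refine ⟨a, mul_left_cancel₀ (pow_ne_zero (p - 1) hj0) (hinj _ _ ?_)⟩
    have e1 : algebraMap B R (j ^ (p - 1) * n ^ (p - 1)) = r ^ (p - 1) • y ^ (p - 1) := by
      rw [← mul_pow, map_pow, hn, smul_pow]
    have e2 : j ^ (p - 1) * (k ^ (p - 1) + p * a) = r ^ (p - 1) + p * (j ^ (p - 1) * a) := by
      rw [hrk]
      ring
    rw [e1, e2, map_add, map_mul, ha, h, smul_add, map_natCast, Algebra.algebraMap_eq_smul_one,
      mul_smul_comm]
  -- If k were in 𝔮, the congruence at a prime p in 𝔮 would put every n in 𝔮, so rM would lie in j𝔮,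
  -- although j lies in rM.
  have hkey : ∀ 𝔮 : Ideal B, 𝔮.IsMaximal → k ∉ 𝔮 := by
    intro 𝔮 h𝔮 hk𝔮
    have hprime := h𝔮.isPrime
    obtain ⟨p, hp, hpm, hp𝔮⟩ := exists_prime_mem (m := m) hm h𝔮
    have hall : ∀ y ∈ M, ∃ a ∈ 𝔮, algebraMap B R (j * a) = r • y := by
      intro y hy
      induction hy using Submodule.span_induction with
      | mem y hy =>
        rcases hy with rfl | hy
        · exact ⟨k, hk𝔮, hk⟩
        · obtain ⟨n, hn⟩ := hdiv y (hSM y hy)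
          obtain ⟨a, ha⟩ := hcong p hp hpm y hy n hn
          refine ⟨n, hprime.mem_of_pow_mem (p - 1) ?_, hn⟩
          rw [ha]
          refine add_mem (Ideal.pow_mem_of_mem _ hk𝔮 _ ?_) (Ideal.mul_mem_right _ _ hp𝔮)
          have := hp.two_le
          omega
      | zero => exact ⟨0, zero_mem _, by simp⟩
      | add y z _ _ h1 h2 =>
        obtain ⟨a, ha, ha'⟩ := h1
        obtain ⟨b, hb, hb'⟩ := h2
        exact ⟨a + b, add_mem ha hb, by rw [mul_add, map_add, ha', hb', smul_add]⟩
      | smul c y _ h1 =>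
        obtain ⟨a, ha, ha'⟩ := h1
        refine ⟨c * a, Ideal.mul_mem_left _ _ ha, ?_⟩
        rw [mul_left_comm, map_mul, ha', ← Algebra.smul_def, smul_comm]
    obtain ⟨y, hy, hyj⟩ := (hJ j).2 ⟨1, (mul_one j).symm⟩
    obtain ⟨a, ha, ha'⟩ := hall y hy
    have h1 : j * a = j * 1 := by
      rw [mul_one]
      exact hinj _ _ (ha'.trans hyj)
    rw [mul_left_cancel₀ hj0 h1] at ha
    exact h𝔮.ne_top ((Ideal.eq_top_iff_one _).2 ha)
  have hku : IsUnit k := by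
    by_contra h
    obtain ⟨𝔮, h𝔮, h1⟩ := exists_max_ideal_of_mem_nonunits h
    exact hkey 𝔮 h𝔮 h1
  obtain ⟨n, hn⟩ := hdiv x (hSM x hx)
  -- The same congruence read backwards: n in 𝔮 would put k in 𝔮.
  have hnu : IsUnit n := by
    by_contra h
    obtain ⟨𝔮, h𝔮, h1⟩ := exists_max_ideal_of_mem_nonunits h
    have hprime := h𝔮.isPrime
    obtain ⟨p, hp, hpm, hp𝔮⟩ := exists_prime_mem (m := m) hm h𝔮
    obtain ⟨a, ha⟩ := hcong p hp hpm x hx n hn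
    refine hkey 𝔮 h𝔮 (hprime.mem_of_pow_mem (p - 1) ?_)
    rw [eq_sub_of_add_eq ha.symm]
    refine sub_mem (Ideal.pow_mem_of_mem _ h1 _ ?_) (Ideal.mul_mem_right _ _ hp𝔮)
    have := hp.two_le
    omega
  obtain ⟨v, hv⟩ := hku.exists_left_inv
  refine ⟨v * n, (IsUnit.of_mul_eq_one k hv).mul hnu, ?_⟩
  have h1 : j • (k • x - algebraMap B R n) = 0 := by
    rw [smul_sub, smul_smul, ← hrk, ← hn, map_mul, Algebra.smul_def, sub_self]
  have h2 : k • x = algebraMap B R n := sub_eq_zero.1 ((htf _ _ h1).resolve_left hj0)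
  rw [map_mul, ← h2, ← Algebra.smul_def, smul_smul, hv, one_smul]

end AwayIntegers

/-! ### Torsion in localizations -/

section Localizations

theorem eq_zero_of_natCast_mul_eq_zero {A A' : Type*} [CommRing A] [CommRing A'] [Algebra A A']
    (S : Submonoid A) [IsLocalization S A'] {p : ℕ} (h : ∀ x : A, (p : A) * x = 0 → x = 0)
    {x : A'} (hx : (p : A') * x = 0) : x = 0 := by
  obtain ⟨a, s, rfl⟩ := IsLocalization.exists_mk'_eq S x
  rw [← map_natCast (algebraMap A A'), ← IsLocalization.mk'_one (M := S) A' (p : A),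
    ← IsLocalization.mk'_mul, IsLocalization.mk'_eq_zero_iff] at hx
  rw [IsLocalization.mk'_eq_zero_iff]
  obtain ⟨c, hc⟩ := hx
  exact ⟨c, h _ (by rw [← hc]; ring)⟩

theorem eq_zero_of_natCast_mul_eq_zero_of_primes {A : Type*} [CommRing A]
    (h : ∀ p : ℕ, p.Prime → ∀ x : A, (p : A) * x = 0 → x = 0) {n : ℕ} (hn : n ≠ 0) :
    ∀ {x : A}, (n : A) * x = 0 → x = 0 := by
  induction n using Nat.recOnMul with
  | zero => exact absurd rfl hn
  | one => intro x hx; simpa using hx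
  | prime p hp => exact h p hp _
  | mul a b ha hb =>
    intro x hx
    rw [Nat.cast_mul, mul_assoc] at hx
    exact hb (right_ne_zero_of_mul hn) (ha (left_ne_zero_of_mul hn) hx)

end Localizations

/-! ### Finite generation after localization -/

section FiniteLocalization

/-- The numerators of finitely many generators serve as F: denominators of the coefficients, and a
factor for equality in the localized module, are cleared by elements of S. -/
theorem exists_finset_smul_mem_span {A M : Type*} [CommRing A] [AddCommGroup M] [Module A M]
    (S : Submonoid A) (h : Module.Finite (Localization S) (LocalizedModule S M)) :
    ∃ F : Finset M, ∀ x : M, ∃ s ∈ S, s • x ∈ Submodule.span A (F : Set M) := by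
  classical
  obtain ⟨F₀, hF₀⟩ := h.fg_top
  choose q hq using fun y : LocalizedModule S M => IsLocalizedModule.mk'_surjective S
    (LocalizedModule.mkLinearMap S M) y
  refine ⟨F₀.image fun y => (q y).1, fun x => ?_⟩
  have h1 : LocalizedModule.mkLinearMap S M x ∈ Submodule.span (Localization S)
      (LocalizedModule.mkLinearMap S M '' (F₀.image fun y => (q y).1 : Finset M)) := by
    have : LocalizedModule.mkLinearMap S M x ∈
        Submodule.span (Localization S) (F₀ : Set (LocalizedModule S M)) := by
      rw [hF₀]
      trivial
    refine Submodule.span_le.2 ?_ this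
    intro y hy
    have h2 : y = IsLocalization.mk' (Localization S) 1 (q y).2 •
        LocalizedModule.mkLinearMap S M (q y).1 := by
      conv_lhs => rw [← hq y]
      simp only [Function.uncurry]
      rw [IsLocalizedModule.mk'_eq_iff, Submonoid.smul_def, ← algebraMap_smul (Localization S),
        smul_smul, IsLocalization.mk'_spec', map_one, one_smul]
    rw [SetLike.mem_coe, h2]
    refine Submodule.smul_mem _ _ (Submodule.subset_span ⟨_, ?_, rfl⟩)
    exact Finset.mem_coe.2 (Finset.mem_image_of_mem _ (Finset.mem_coe.1 hy))
  obtain ⟨t, ht⟩ := multiple_mem_span_of_mem_localization_span S (Localization S) _ _ h1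
  rw [← Submodule.map_span] at ht
  obtain ⟨z, hz, hz'⟩ := ht
  have h3 : LocalizedModule.mkLinearMap S M z = LocalizedModule.mkLinearMap S M ((t : A) • x) := by
    rw [hz', map_smul]
    rfl
  obtain ⟨c, hc⟩ := (IsLocalizedModule.eq_iff_exists S (LocalizedModule.mkLinearMap S M)).1 h3
  refine ⟨c * t, S.mul_mem c.2 t.2, ?_⟩
  rw [mul_smul]
  change c • (t : A) • x ∈ _
  rw [← hc]
  exact Submodule.smul_mem _ (c : A) hz

end FiniteLocalization

/-! ### Images of spans and of their powers -/

section Map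

variable {B T R : Type*} [CommRing B] [CommRing T] [CommRing R] [Algebra B R]

theorem map_mem_span (ρ : T →+* R) {S : Set T} {M : Submodule B R} (h : ∀ t ∈ S, ρ t ∈ M) {t : T}
    (ht : t ∈ Submodule.span ℤ S) : ρ t ∈ M := by
  induction ht using Submodule.span_induction with
  | mem s hs => exact h s hs
  | zero =>
    rw [map_zero]
    exact zero_mem _
  | add a b _ _ h1 h2 =>
    rw [map_add]
    exact add_mem h1 h2
  | smul z a _ h1 =>
    rw [map_zsmul]
    exact zsmul_mem h1 z

theorem map_mem_pow (ρ : T →+* R) {M : Submodule B R} {N : Submodule ℤ T}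
    (h : ∀ t ∈ N, ρ t ∈ M) {n : ℕ} {t : T} (ht : t ∈ N ^ n) : ρ t ∈ M ^ n := by
  induction ht using Submodule.pow_induction_on_left' with
  | algebraMap z =>
    rw [pow_zero, eq_intCast, map_intCast, ← map_intCast (algebraMap B R)]
    exact Submodule.algebraMap_mem _
  | add x y i _ _ h1 h2 =>
    rw [map_add]
    exact add_mem h1 h2
  | mem_mul x hx i y _ h1 =>
    rw [map_mul, Nat.succ_eq_add_one, pow_succ']
    exact Submodule.mul_mem_mul (h x hx) h1

end Map

/-! ### The dichotomy: ℤ[1/m] or zero -/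

section Dichotomy

variable {m : ℕ} {B T T' R : Type*} [CommRing B] [CommRing T] [CommRing T'] [CommRing R]
  [Algebra ℤ B] [IsLocalization.Away (m : ℤ) B] [Algebra T T'] {W : Submonoid T}
  [IsLocalization W T'] [Algebra T' R] [IsLocalization.Away (m : T') R]

theorem isUnit_natCast_away_of_natCast (T' : Type*) {R : Type*} [CommRing T'] [CommRing R]
    [Algebra T' R] (m : ℕ) [IsLocalization.Away (m : T') R] : IsUnit (m : R) := by
  have := IsLocalization.Away.algebraMap_isUnit (S := R) (m : T')
  rwa [map_natCast] at this

/-- The set `S` generates `T` as a ring, and each generator satisfies a refined Fermat congruence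
modulo every prime that does not divide `m`. -/
structure IsFermatGenerating (m : ℕ) (W : Submonoid T) (S : Set T) : Prop where
  subset : S ⊆ W
  le_closure : W ≤ Submonoid.closure S
  closure_eq : Subring.closure S = ⊤
  finite : ∃ F : Finset T, ∀ t ∈ Submodule.span ℤ S, ∃ k : ℕ,
    (m : T) ^ k * t ∈ Submodule.span ℤ (F : Set T)
  torsion : ∀ p : ℕ, p.Prime → ¬ p ∣ m → ∀ t : T, (p : T) * t = 0 → t = 0
  pow_eq : ∀ p : ℕ, p.Prime → ¬ p ∣ m → ∀ t ∈ S,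
    ∃ c ∈ Submodule.span ℤ S ^ (p - 1), t ^ p = t + p * (t * c)

variable [Algebra B R] {S : Set T}

/-- Up to a unit b is an integer. Its prime factors dividing m are units in R, and the others are
not zero divisors since localization preserves this. -/
theorem smul_eq_zero_of_localization
    (ht : ∀ p : ℕ, p.Prime → ¬ p ∣ m → ∀ t : T, (p : T) * t = 0 → t = 0)
    (W : Submonoid T) (T' : Type*) [CommRing T'] [Algebra T T'] [IsLocalization W T']
    [Algebra T' R] [IsLocalization.Away (m : T') R] (b : B) (x : R) (h : b • x = 0) :
    b = 0 ∨ x = 0 := by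
  obtain ⟨⟨z, s⟩, hz⟩ := IsLocalization.surj (Submonoid.powers (m : ℤ)) b
  by_cases hz0 : z = 0
  · left
    rw [hz0, map_zero] at hz
    exact (IsLocalization.map_units _ s).mul_left_eq_zero.1 hz
  · right
    have h1 : (z : R) * x = 0 := by
      have : algebraMap ℤ B z • x = 0 := by
        rw [← hz, mul_comm, mul_smul, h, smul_zero]
      rwa [Algebra.smul_def, eq_intCast, map_intCast] at this
    have h2 : (z.natAbs : R) * x = 0 := by
      rcases Int.natAbs_eq z with h3 | h3
      · rw [h3, Int.cast_natCast] at h1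
        exact h1
      · rw [h3, Int.cast_neg, Int.cast_natCast, neg_mul, neg_eq_zero] at h1
        exact h1
    refine eq_zero_of_natCast_mul_eq_zero_of_primes (fun p hp y hy => ?_)
      (Int.natAbs_ne_zero.2 hz0) h2
    by_cases hpm : p ∣ m
    · obtain ⟨k, hk⟩ := hpm
      have hu := isUnit_natCast_away_of_natCast T' (R := R) m
      rw [hk, Nat.cast_mul] at hu
      exact (isUnit_of_mul_isUnit_left hu).mul_right_eq_zero.1 hy
    · exact eq_zero_of_natCast_mul_eq_zero (Submonoid.powers (m : T'))
        (fun w hw => eq_zero_of_natCast_mul_eq_zero W (ht p hp hpm) hw) hy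

/-- As m is invertible in B, the images of S lie in the span of 1 and the images of F, and B is
noetherian. -/
theorem IsFermatGenerating.fg (hS : IsFermatGenerating m W S) (ρ : T →+* R) :
    (Submodule.span B (insert 1 (ρ '' S))).FG := by
  classical
  have hN : IsNoetherianRing B := IsLocalization.isNoetherianRing (Submonoid.powers (m : ℤ)) _
    inferInstance
  obtain ⟨F, hF⟩ := hS.finite
  refine Submodule.FG.of_le (Submodule.fg_span (R := B)
    ((F.image ρ).finite_toSet.insert (1 : R))) ?_
  rw [Submodule.span_le]
  rintro _ (rfl | ⟨t, ht, rfl⟩)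
  · exact Submodule.subset_span (Set.mem_insert _ _)
  · obtain ⟨k, hk⟩ := hF t (Submodule.subset_span ht)
    have h1 := map_mem_span (B := B) ρ (M := Submodule.span B (insert 1 (F.image ρ : Set R)))
      (fun s hs => Submodule.subset_span (Set.mem_insert_of_mem _
        (Finset.mem_coe.2 (Finset.mem_image_of_mem ρ hs)))) hk
    obtain ⟨v, hv⟩ := ((isUnit_natCast_away (m := m) (B := B)).pow k).exists_left_inv
    have h2 := Submodule.smul_mem _ v h1
    have h3 : v • ρ ((m : T) ^ k * t) = ρ t := by
      rw [map_mul, map_pow, map_natCast, ← map_natCast (algebraMap B R), ← map_pow,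
        ← Algebra.smul_def, smul_smul, hv, one_smul]
    rwa [h3] at h2

variable (B R) in
-- The elements of S become units of B, hence so do those of W, and T maps into B because S
-- generates it. So every fraction lies in B, and torsion-freeness makes B → R injective.
theorem IsFermatGenerating.nonempty_ringEquiv (hS : IsFermatGenerating m W S) (hm : Odd m)
    (T' : Type*) [CommRing T'] [Algebra T T'] [IsLocalization W T']
    [Algebra T' R] [IsLocalization.Away (m : T') R] [Nontrivial R] :
    Nonempty (R ≃+* B) := by
  have hm0 : m ≠ 0 := by
    rintro rfl
    simp at hm
  have : IsDomain B :=
    IsLocalization.isDomain_of_le_nonZeroDivisors B (M := Submonoid.powers (m : ℤ))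
      (powers_le_nonZeroDivisors_of_noZeroDivisors (by exact_mod_cast hm0))
  have htf := smul_eq_zero_of_localization (B := B) (R := R) hS.torsion W T'
  let ρ : T →+* R := (algebraMap T' R).comp (algebraMap T T')
  have hρ : ∀ t ∈ W, IsUnit (ρ t) := fun t ht =>
    (IsLocalization.map_units T' (⟨t, ht⟩ : W)).map (algebraMap T' R)
  have hb : ∀ t ∈ S, ∃ b : B, IsUnit b ∧ algebraMap B R b = ρ t := by
    intro t ht
    refine exists_isUnit_algebraMap_eq hm htf (S := ρ '' S) ?_ (hS.fg ρ) ?_ ⟨t, ht, rfl⟩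
    · rintro _ ⟨t, ht, rfl⟩
      exact hρ t (hS.subset ht)
    · rintro p hp hpm _ ⟨t, ht, rfl⟩
      obtain ⟨c, hc, h⟩ := hS.pow_eq p hp hpm t ht
      refine ⟨ρ c, map_mem_pow ρ (fun s hs => map_mem_span ρ (fun s hs => ?_) hs) hc, ?_⟩
      · exact Submodule.subset_span (Set.mem_insert_of_mem _ ⟨s, hs, rfl⟩)
      · rw [← map_pow, h, map_add, map_mul, map_mul, map_natCast]
  have hW : ∀ t ∈ W, ∃ b : B, IsUnit b ∧ algebraMap B R b = ρ t := by
    intro t ht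
    replace ht := hS.le_closure ht
    induction ht using Submonoid.closure_induction with
    | mem t ht => exact hb t ht
    | one => exact ⟨1, isUnit_one, by rw [map_one, map_one]⟩
    | mul s t _ _ h1 h2 =>
      obtain ⟨a, hau, ha⟩ := h1
      obtain ⟨b, hbu, hb⟩ := h2
      exact ⟨a * b, hau.mul hbu, by rw [map_mul, map_mul, ha, hb]⟩
  have hT : ∀ t, ρ t ∈ (algebraMap B R).range := by
    intro t
    have h1 : Subring.closure S ≤ (algebraMap B R).range.comap ρ := by
      rw [Subring.closure_le]
      intro s hs
      obtain ⟨b, -, h⟩ := hb s hs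
      exact ⟨b, h⟩
    exact h1 (by rw [hS.closure_eq]; trivial)
  refine ⟨(RingEquiv.ofBijective (algebraMap B R) ⟨?_, fun x => ?_⟩).symm⟩
  · rw [injective_iff_map_eq_zero]
    intro b hb
    rw [Algebra.algebraMap_eq_smul_one] at hb
    exact (htf b 1 hb).resolve_right one_ne_zero
  · obtain ⟨⟨y, ⟨_, k, rfl⟩⟩, hy⟩ := IsLocalization.surj (Submonoid.powers (m : T')) x
    obtain ⟨⟨a, s⟩, ha⟩ := IsLocalization.surj W y
    obtain ⟨c, hc⟩ := hT a
    obtain ⟨d, hdu, hd⟩ := hW s s.2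
    have h : x * ((m : R) ^ k * ρ s) = ρ a := by
      have h1 : ρ a = algebraMap T' R y * ρ s := by
        change algebraMap T' R (algebraMap T T' a) = _ * algebraMap T' R (algebraMap T T' s)
        rw [← ha, map_mul]
      rw [h1, ← hy, map_pow, map_natCast, mul_assoc]
    have hu : IsUnit ((m : B) ^ k * d) := ((isUnit_natCast_away (m := m)).pow k).mul hdu
    obtain ⟨v, hv⟩ := hu.exists_right_inv
    refine ⟨c * v, ?_⟩
    rw [map_mul, hc, ← h, ← hd, ← map_natCast (algebraMap B R) m,
      ← map_pow, ← map_mul, mul_assoc, ← map_mul, hv, map_one, mul_one]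

/-- Under the Fermat congruences, the localization `R` of `T` is `ℤ[1/m]` or zero, according to
whether `T` has a homomorphism to the field with two elements that does not vanish on `W`. -/
theorem IsFermatGenerating.dichotomy (hS : IsFermatGenerating m W S) (hm : Odd m)
    (B T' R : Type*) [CommRing B] [CommRing T'] [CommRing R]
    [Algebra ℤ B] [IsLocalization.Away (m : ℤ) B] [Algebra T T']
    [IsLocalization W T'] [Algebra T' R] [IsLocalization.Away (m : T') R] :
    ((∃ μ : T →+* ZMod 2, ∀ t ∈ W, μ t = 1) → Nonempty (R ≃+* B)) ∧
      ((¬ ∃ μ : T →+* ZMod 2, ∀ t ∈ W, μ t = 1) → Subsingleton R) := by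
  let : Algebra B R := (IsLocalization.Away.lift (m : ℤ) (g := Int.castRingHom R) (by
    simpa using isUnit_natCast_away_of_natCast T' m)).toAlgebra
  constructor
  · rintro ⟨μ, hμ⟩
    -- μ is 1 on W and m is odd, so μ extends to R, which is therefore nonzero.
    let μ' : T' →+* ZMod 2 := IsLocalization.lift (M := W) (g := μ) fun t => by
      rw [hμ t t.2]
      exact isUnit_one
    let μ'' : R →+* ZMod 2 := IsLocalization.Away.lift (m : T') (g := μ') (by
      rw [map_natCast, ZMod.natCast_eq_one_iff_odd.2 hm]
      exact isUnit_one)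
    have := μ''.domain_nontrivial
    exact hS.nonempty_ringEquiv B R hm T'
  · intro hμ
    by_contra h
    rw [not_subsingleton_iff_nontrivial] at h
    obtain ⟨e⟩ := hS.nonempty_ringEquiv B R hm T'
    obtain ⟨φ⟩ := exists_hom_zmod_two (m := m) (B := B) hm
    refine hμ ⟨(φ.comp e.toRingHom).comp ((algebraMap T' R).comp (algebraMap T T')), fun t ht => ?_⟩
    have h1 := (IsLocalization.map_units T' (⟨t, ht⟩ : W)).map
      ((φ.comp e.toRingHom).comp (algebraMap T' R))
    -- Elements of W become units in R, and the only unit of `ZMod 2` is 1.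
    have h2 : ∀ a : ZMod 2, IsUnit a → a = 1 := by decide
    exact h2 _ h1

theorem IsFermatGenerating.dichotomy_localization (hS : IsFermatGenerating m W S) (hm : Odd m) :
    ((∃ μ : T →+* ZMod 2, ∀ t ∈ W, μ t = 1) →
      Nonempty (Localization.Away (m : Localization W) ≃+* Localization.Away (m : ℤ))) ∧
      ((¬ ∃ μ : T →+* ZMod 2, ∀ t ∈ W, μ t = 1) →
        Subsingleton (Localization.Away (m : Localization W))) :=
  hS.dichotomy hm _ (Localization W) _

end Dichotomy

/-! ### Application to the basic classes -/

section Main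

variable {G Ω : Type u} [Group G] [MulAction G Ω]

theorem cl_mem_closure_of_isTransitive {Y X : SmoothSet (stabClass G Ω)} (hY : Y.IsTransitive)
    (hX : X.IsTransitive) (f : Y →[G] X) : cl f hX ∈ Submonoid.closure (basicClasses G Ω) := by
  obtain ⟨B, hB, h⟩ := exists_list_prod_eq_of_isTransitive hY hX f
  rw [h]
  exact Submonoid.list_prod_mem _ fun b hb => Submonoid.subset_closure (hB b hb)

theorem isFermatGenerating_basicClasses (hG : IsOligomorphic G Ω) {m : ℕ}
    (hgen : GEN G Ω m) (hind : IND G Ω m) :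
    IsFermatGenerating m (regularMonoid (stabClass G Ω)) (basicClasses G Ω) where
  subset := by
    rintro _ ⟨l, x, rfl⟩
    exact Submonoid.subset_closure ⟨basicMap G x, orbitSet_isTransitive x, rfl⟩
  le_closure := by
    refine Submonoid.closure_le.2 ?_
    rintro _ ⟨⟨Y, X, f, hX⟩, hY, rfl⟩
    exact cl_mem_closure_of_isTransitive hY hX f
  closure_eq := by
    rw [eq_top_iff]
    rintro t -
    obtain ⟨q, rfl⟩ := Ideal.Quotient.mk_surjective t
    induction q using MvPolynomial.induction_on with
    | C z =>
      have : Ideal.Quotient.mk (relIdeal (stabClass G Ω)) (MvPolynomial.C z) = (z : Theta _) := by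
        simp
      rw [this]
      exact intCast_mem _ z
    | add p q hp hq =>
      rw [map_add]
      exact add_mem hp hq
    | mul_X p f hp =>
      obtain ⟨Y, X, f, hX⟩ := f
      rw [map_mul]
      refine mul_mem hp ?_
      rw [mk_X, cl_eq_sum_orbits]
      refine sum_mem fun o _ => ?_
      exact Submonoid.closure_le.2 (fun t ht => Subring.subset_closure ht :
        basicClasses G Ω ⊆ (Subring.closure (basicClasses G Ω)).toSubmonoid)
        (cl_mem_closure_of_isTransitive (orbitSub_isTransitive Y o) hX _)
  finite := by
    classical
    obtain ⟨F, hF⟩ := exists_finset_smul_mem_span (Submonoid.powers (m : ℤ)) hgen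
    refine ⟨F.image (thetaLeOne G Ω).subtype, fun t ht => ?_⟩
    obtain ⟨_, ⟨k, rfl⟩, hk⟩ := hF ⟨t, ht⟩
    refine ⟨k, ?_⟩
    have h1 := Submodule.mem_map_of_mem (f := (thetaLeOne G Ω).subtype) hk
    rw [Submodule.map_span, ← Finset.coe_image] at h1
    convert h1 using 1
    simp
  torsion p hp hpm t ht := by
    have : Fact p.Prime := ⟨hp⟩
    exact eq_zero_of_prime_mul_eq_zero (prodClosed_stabClass hG) (rotFree_stabClass hind hp hpm) ht
  pow_eq p hp hpm t ht := by
    have : Fact p.Prime := ⟨hp⟩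
    exact basicClasses_pow_eq hG (rotFree_stabClass hind hp hpm) ht

theorem isOdd_iff_exists_hom (hG : IsOligomorphic G Ω) : IsOdd G Ω ↔
    ∃ μ : Theta (stabClass G Ω) →+* ZMod 2, ∀ t ∈ regularMonoid (stabClass G Ω), μ t = 1 :=
  ⟨exists_hom_of_isOdd hG, fun ⟨μ, hμ⟩ => isOdd_of_hom hG μ hμ⟩

end Main

end Oligo

theorem theorem3p11 {G Ω : Type u} [Group G] [MulAction G Ω] [FaithfulSMul G Ω]
    (hG : Oligo.IsOligomorphic G Ω) (m : ℕ) (hm : Odd m)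
    (hgen : Oligo.GEN G Ω m) (hind : Oligo.IND G Ω m) :
    (Oligo.IsOdd G Ω →
      Nonempty (Localization.Away (m : Oligo.ThetaStar (Oligo.stabClass G Ω)) ≃+*
        Localization.Away (m : ℤ))) ∧
    (¬ Oligo.IsOdd G Ω →
      Subsingleton (Localization.Away (m : Oligo.ThetaStar (Oligo.stabClass G Ω)))) := by
  rw [Oligo.isOdd_iff_exists_hom hG]
  exact (Oligo.isFermatGenerating_basicClasses hG hgen hind).dichotomy_localization hm
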